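/- **Theorem.** Let $\mathbb{F}$ be a field and let $1\le k\le n$ be integers. In $\mathbb{F}[\mathbf{x}_n]=\mathbb{F}[x_1,\dots,x_n]$ let $h_d(x_1,\dots,x_i)$ be the complete homogeneous symmetric polynomial of degree $d$ in $x_1,\dots,x_i$, let $e_d(\mathbf{x}_n)$ be the elementary symmetric polynomial of degree $d$ in all $n$ variables, and let $J_{n,k}$ be the ideal $$J_{n,k}=\langle h_k(x_1),h_k(x_1,x_2),\dots,h_k(x_1,\dots,x_n),\,e_n(\mathbf{x}_n),e_{n-1}(\mathbf{x}_n),\dots,e_{n-k+1}(\mathbf{x}_n)\rangle.$$ Let $\leq$ be the term order neglex, that is, the lexicographic order for $x_n>\cdots>x_2>x_1$: $x_1^{a_1}\cdots x_n^{a_n}<x_1^{b_1}\cdots x_n^{b_n}$ if and only if there is a $j$ with $a_{j}<b_{j}$ and $a_i=b_i$ for all $i>j$. For $1\le i\le n-1$ let $\pi_i(f)=\dfrac{x_if-x_{i+1}s_i(f)}{x_i-x_{i+1}}$, where $s_i$ exchanges $x_i$ and $x_{i+1}$. The Demazure character $\kappa_\gamma(\mathbf{x}_n)$ of $\gamma\in\mathbb{Z}_{\ge0}^n$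 is determined by $\kappa_\gamma=x_1^{\gamma_1}\cdots x_n^{\gamma_n}$ if $\gamma_1\ge\cdots\ge\gamma_n$, and $\kappa_\gamma=\pi_i(\kappa_{\gamma'})$ whenever $\gamma_i<\gamma_{i+1}$, where $\gamma'$ is $\gamma$ with the entries $\gamma_i,\gamma_{i+1}$ exchanged. For $S=\{s_1<\cdots<s_m\}\subseteq[n]$ let $\gamma(S)=(\gamma_1,\dots,\gamma_n)$ with $\gamma_i=s_j-j+1$ if $i=s_j\in S$ and $\gamma_i=0$ if $i\notin S$, and let $\gamma(S)^*=(\gamma_n,\dots,\gamma_1)$. Then the polynomials $h_k(x_1,\dots,x_i)$ for $1\le i\le n$, together with the Demazure characters $\kappa_{\gamma(S)^*}(\mathbf{x}_n)$ for all $S\subseteq[n-1]$ with $|S|=n-k+1$, form a Gröbner basis of $J_{n,k}$ with respect to $\leq$; that is, they are nonzero elements of $J_{n,k}$ whose leading terms generate the ideal $\langle \mathrm{in}_<(f): f\in J_{n,k}\setminus\{0\}\rangle$. If $k<n$, this Gröbner basis is minimal: all its elements have leading coefficient $1$, and the leading monomial of an element never divides the leading monomial of a different element. -/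

import Mathlib

open MvPolynomial

namespace ZeroHecke

noncomputable section

/-! ### The `neglex` term order -/

/-- The lexicographic term order on `F[x_1, …, x_n]` for the variable order `x_n > ⋯ > x_1`.
The variable `x_i` is `X ⟨i - 1, _⟩`. -/
def neglex (n : ℕ) : MonomialOrder (Fin n) where
  syn := Colex (Fin n →₀ ℕ)
  toSyn := { toEquiv := toColex, map_add' := fun _ _ => rfl }
  toSyn_monotone := Finsupp.toColex_monotone

theorem neglex_lt_iff {n : ℕ} (a b : Fin n →₀ ℕ) :
    (neglex n).toSyn a < (neglex n).toSyn b ↔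
      ∃ j, (∀ i, j < i → a i = b i) ∧ a j < b j :=
  Finsupp.Colex.lt_iff

/-! ### Gröbner bases -/

section Groebner

variable {σ F : Type*} [Field F]

/-- The initial ideal `⟨in(f) : f ∈ I, f ≠ 0⟩`. -/
def initialIdeal (m : MonomialOrder σ) (I : Ideal (MvPolynomial σ F)) :
    Ideal (MvPolynomial σ F) :=
  Ideal.span (m.leadingTerm '' {f | f ∈ I ∧ f ≠ 0})

/-- `G` is a Gröbner basis of `I`: a finite set of nonzero elements of `I` whose leading terms
generate the initial ideal. -/
structure IsGroebnerBasis (m : MonomialOrder σ) (G : Set (MvPolynomial σ F))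
    (I : Ideal (MvPolynomial σ F)) : Prop where
  finite : G.Finite
  mem : ∀ g ∈ G, g ∈ I
  ne_zero : ∀ g ∈ G, g ≠ 0
  initialIdeal_eq : initialIdeal m I = Ideal.span (m.leadingTerm '' G)

/-- A Gröbner basis is minimal if its elements have leading coefficient `1` and no leading
monomial divides the leading monomial of another element. -/
structure IsMinimalGroebnerBasis (m : MonomialOrder σ) (G : Set (MvPolynomial σ F))
    (I : Ideal (MvPolynomial σ F)) : Prop extends IsGroebnerBasis m G I where
  leadingCoeff_eq_one : ∀ g ∈ G, m.leadingCoeff g = 1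
  not_dvd : ∀ g ∈ G, ∀ g' ∈ G, g ≠ g' →
    ¬ monomial (m.degree g) (1 : F) ∣ monomial (m.degree g') (1 : F)

end Groebner

/-! ### The ideal `J_{n,k}` -/

/-- The complete homogeneous symmetric polynomial `h_d(x_1, …, x_i)` in `F[x_1, …, x_n]`. -/
def completeHomogeneous (F : Type*) [Field F] (n d i : ℕ) (hi : i ≤ n) :
    MvPolynomial (Fin n) F :=
  rename (Fin.castLE hi) (hsymm (Fin i) F d)

/-- The ideal `J_{n,k} = ⟨h_k(x_1), …, h_k(x_1, …, x_n), e_n, e_{n-1}, …, e_{n-k+1}⟩`. -/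
def idealJ (F : Type*) [Field F] (n k : ℕ) : Ideal (MvPolynomial (Fin n) F) :=
  Ideal.span
    ({f | ∃ (i : ℕ) (hi : i ≤ n), 1 ≤ i ∧ f = completeHomogeneous F n k i hi} ∪
      {f | ∃ d : ℕ, n - k + 1 ≤ d ∧ d ≤ n ∧ f = esymm (Fin n) F d})

/-! ### Isobaric Demazure operators -/

section Demazure

variable {n : ℕ} {F : Type*} [Field F]

theorem sub_dvd_sub_rename (i j : Fin n) (f : MvPolynomial (Fin n) F) :
    (X i - X j : MvPolynomial (Fin n) F) ∣ f - rename (Equiv.swap i j) f := by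
  induction f using MvPolynomial.induction_on with
  | C a => simp
  | add p q hp hq =>
    have := dvd_add hp hq
    rw [map_add]
    convert this using 1
    ring
  | mul_X p a hp =>
    have hX : (X i - X j : MvPolynomial (Fin n) F) ∣ X a - X (Equiv.swap i j a) := by
      rcases eq_or_ne a i with rfl | hai
      · simp
      · rcases eq_or_ne a j with rfl | haj
        · rw [Equiv.swap_apply_right]
          exact ⟨-1, by ring⟩
        · rw [Equiv.swap_apply_of_ne_of_ne hai haj]
          simp
    have := dvd_add (hp.mul_right (X a)) (hX.mul_left (rename (Equiv.swap i j) p))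
    rw [map_mul, rename_X]
    convert this using 1
    ring

theorem exists_isobaric (i j : Fin n) (f : MvPolynomial (Fin n) F) :
    ∃ g : MvPolynomial (Fin n) F,
      (X i - X j) * g = X i * f - X j * rename (Equiv.swap i j) f := by
  obtain ⟨c, hc⟩ := sub_dvd_sub_rename i j f
  exact ⟨f + X j * c, by linear_combination (-X j) * hc⟩

/-- The quotient `(x_i f - x_j s(f)) / (x_i - x_j)`, where `s` exchanges `x_i` and `x_j`. The
division is exact (`isobaric_spec`), and for `i ≠ j` the quotient is unique (`isobaric_unique`).
For `j = i + 1` this is the isobaric Demazure operator `π_i`. -/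
def isobaric (i j : Fin n) (f : MvPolynomial (Fin n) F) : MvPolynomial (Fin n) F :=
  Classical.choose (exists_isobaric i j f)

theorem isobaric_spec (i j : Fin n) (f : MvPolynomial (Fin n) F) :
    (X i - X j) * isobaric i j f = X i * f - X j * rename (Equiv.swap i j) f :=
  Classical.choose_spec (exists_isobaric i j f)

theorem X_sub_X_ne_zero {i j : Fin n} (h : i ≠ j) :
    (X i - X j : MvPolynomial (Fin n) F) ≠ 0 :=
  sub_ne_zero.mpr fun h' => h (X_injective h')

theorem isobaric_unique {i j : Fin n} (h : i ≠ j) {f g : MvPolynomial (Fin n) F}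
    (hg : (X i - X j) * g = X i * f - X j * rename (Equiv.swap i j) f) :
    g = isobaric i j f :=
  mul_left_cancel₀ (X_sub_X_ne_zero h) (hg.trans (isobaric_spec i j f).symm)

theorem rename_isobaric (e : Equiv.Perm (Fin n)) (i j : Fin n) (f : MvPolynomial (Fin n) F) :
    (X (e i) - X (e j)) * rename e (isobaric i j f) =
      X (e i) * rename e f - X (e j) * rename e (rename (Equiv.swap i j) f) := by
  have := congrArg (rename e) (isobaric_spec i j f)
  simpa only [map_mul, map_sub, rename_X] using this

theorem rename_swap_isobaric {i j : Fin n} (h : i ≠ j) (f : MvPolynomial (Fin n) F) :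
    rename (Equiv.swap i j) (isobaric i j f) = isobaric i j f := by
  apply isobaric_unique h
  have h1 := rename_isobaric (Equiv.swap i j) i j f
  have h2 : rename (Equiv.swap i j) (rename (Equiv.swap i j) f) = f := by
    rw [rename_rename]
    convert rename_id_apply f using 2
    ext a
    simp
  rw [Equiv.swap_apply_left, Equiv.swap_apply_right, h2] at h1
  linear_combination -h1

theorem isobaric_comm {i j k l : Fin n} (hij : i ≠ j) (hkl : k ≠ l) (hik : i ≠ k) (hil : i ≠ l)
    (hjk : j ≠ k) (hjl : j ≠ l) (f : MvPolynomial (Fin n) F) :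
    isobaric i j (isobaric k l f) = isobaric k l (isobaric i j f) := by
  have h1 := isobaric_spec i j (isobaric k l f)
  have h2 := isobaric_spec k l (isobaric i j f)
  have h3 := isobaric_spec i j f
  have h4 := isobaric_spec k l f
  have h5 := rename_isobaric (Equiv.swap i j) k l f
  have h6 := rename_isobaric (Equiv.swap k l) i j f
  rw [Equiv.swap_apply_of_ne_of_ne hik.symm hjk.symm,
    Equiv.swap_apply_of_ne_of_ne hil.symm hjl.symm] at h5
  rw [Equiv.swap_apply_of_ne_of_ne hik hil, Equiv.swap_apply_of_ne_of_ne hjk hjl] at h6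
  have h7 : rename (Equiv.swap i j) (rename (Equiv.swap k l) f) =
      rename (Equiv.swap k l) (rename (Equiv.swap i j) f) := by
    simp only [rename_rename]
    congr 2
    have : Equiv.Perm.Disjoint (Equiv.swap i j) (Equiv.swap k l) := by
      intro a
      by_cases ha : a = i ∨ a = j
      · right
        rcases ha with rfl | rfl
        · exact Equiv.swap_apply_of_ne_of_ne hik hil
        · exact Equiv.swap_apply_of_ne_of_ne hjk hjl
      · push Not at ha
        exact Or.inl (Equiv.swap_apply_of_ne_of_ne ha.1 ha.2)
    exact congrArg DFunLike.coe this.commute.eq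
  rw [h7] at h5
  apply mul_left_cancel₀ (mul_ne_zero (X_sub_X_ne_zero (F := F) hij) (X_sub_X_ne_zero hkl))
  linear_combination (X k - X l) * h1 - (X i - X j) * h2 + X i * h4 - X j * h5
    - X k * h3 + X l * h6

theorem isobaric_braid {i j k : Fin n} (hij : i ≠ j) (hjk : j ≠ k) (hik : i ≠ k)
    (f : MvPolynomial (Fin n) F) :
    isobaric i j (isobaric j k (isobaric i j f)) =
      isobaric j k (isobaric i j (isobaric j k f)) := by
  set s := Equiv.swap i j with hs
  set t := Equiv.swap j k with ht
  have si : s i = j := Equiv.swap_apply_left _ _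
  have sj : s j = i := Equiv.swap_apply_right _ _
  have sk : s k = k := Equiv.swap_apply_of_ne_of_ne hik.symm hjk.symm
  have ti : t i = i := Equiv.swap_apply_of_ne_of_ne hij hik
  have tj : t j = k := Equiv.swap_apply_left _ _
  have tk : t k = j := Equiv.swap_apply_right _ _
  have hst : rename s (rename t (rename s f)) = rename t (rename s (rename t f)) := by
    simp only [rename_rename]
    congr 2
    funext a
    simp only [Function.comp, hs, ht, Equiv.swap_apply_def]
    split_ifs <;> simp_all
  have p1 := isobaric_spec i j (isobaric j k (isobaric i j f))
  have p2 := isobaric_spec j k (isobaric i j f)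
  have p2s := rename_isobaric s j k (isobaric i j f)
  have p3 := isobaric_spec i j f
  have p3t := rename_isobaric t i j f
  have p3st := congrArg (rename s) p3t
  have q1 := isobaric_spec j k (isobaric i j (isobaric j k f))
  have q2 := isobaric_spec i j (isobaric j k f)
  have q2t := rename_isobaric t i j (isobaric j k f)
  have q3 := isobaric_spec j k f
  have q3s := rename_isobaric s j k f
  have q3ts := congrArg (rename t) q3s
  have p0 := rename_swap_isobaric hij f
  have q0 := rename_swap_isobaric hjk f
  simp only [← hs, ← ht, map_mul, map_sub, rename_X, si, sj, sk, ti, tj, tk] at *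
  rw [p0] at p2s
  rw [q0] at q2t
  rw [hst] at p3st
  apply mul_left_cancel₀ (mul_ne_zero (mul_ne_zero (X_sub_X_ne_zero (F := F) hij)
    (X_sub_X_ne_zero hik)) (X_sub_X_ne_zero hjk))
  linear_combination (X i - X k) * (X j - X k) * p1 + X i * (X i - X k) * p2
    - X j * (X j - X k) * p2s + X i * X j * p3 - X i * X k * p3t + X j * X k * p3st
    - (X i - X j) * (X i - X k) * q1 - X j * (X i - X k) * q2 + X k * (X i - X j) * q2t
    - X i * X i * q3 + X j * X j * q3s - X k * X k * q3ts

/-! ### Demazure characters -/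

/-- The weak composition `s_i γ`, with the entries in the `i`-th and `j`-th places exchanged. -/
def exchange (γ : Fin n → ℕ) (i j : Fin n) : Fin n → ℕ := γ ∘ Equiv.swap i j

theorem weight_exchange_lt (γ : Fin n → ℕ) {i j : Fin n} (hij : i < j) (h : γ i < γ j) :
    ∑ a : Fin n, (a : ℕ) * exchange γ i j a < ∑ a : Fin n, (a : ℕ) * γ a := by
  have e : ∑ a : Fin n, (a : ℕ) * exchange γ i j a =
      ∑ a : Fin n, (Equiv.swap i j a : ℕ) * γ a := by
    rw [← Equiv.sum_comp (Equiv.swap i j)]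
    simp [exchange]
  rw [e, ← Nat.cast_lt (α := ℤ), ← sub_pos, Nat.cast_sum, Nat.cast_sum, ← Finset.sum_sub_distrib,
    Fintype.sum_eq_add i j hij.ne]
  · rw [Equiv.swap_apply_left, Equiv.swap_apply_right]
    push_cast
    have h1 : (0 : ℤ) < (j : ℕ) - (i : ℕ) := by
      have : (i : ℕ) < j := hij
      omega
    have h2 : (0 : ℤ) < (γ j : ℤ) - γ i := by omega
    nlinarith [mul_pos h1 h2]
  · rintro a ⟨h1, h2⟩
    rw [Equiv.swap_apply_of_ne_of_ne h1 h2, sub_self]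

open Classical in
/-- The Demazure character (key polynomial) `κ_γ` of a weak composition `γ` of length `n`:
`κ_γ = x^γ` if `γ` is weakly decreasing, and `κ_γ = π_i (κ_{s_i γ})` whenever `γ_i < γ_{i+1}`.
The value does not depend on the place `i` that is chosen in each step
(`demazureCharacter_of_lt`). -/
def demazureCharacter (F : Type*) [Field F] (γ : Fin n → ℕ) : MvPolynomial (Fin n) F :=
  if h : ∃ p : Fin n × Fin n, (p.2 : ℕ) = p.1 + 1 ∧ γ p.1 < γ p.2 then
    isobaric h.choose.1 h.choose.2
      (demazureCharacter F (exchange γ h.choose.1 h.choose.2))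
  else monomial (Finsupp.equivFunOnFinite.symm γ) 1
termination_by ∑ a : Fin n, (a : ℕ) * γ a
decreasing_by
  exact weight_exchange_lt γ (Fin.lt_def.mpr (by have := h.choose_spec.1; omega))
    h.choose_spec.2

theorem demazureCharacter_of_antitone {γ : Fin n → ℕ} (hγ : Antitone γ) :
    demazureCharacter F γ = monomial (Finsupp.equivFunOnFinite.symm γ) 1 := by
  rw [demazureCharacter, dif_neg]
  rintro ⟨p, hp, h⟩
  exact absurd (hγ (Fin.le_def.mpr (by omega : (p.1 : ℕ) ≤ p.2))) (not_le.mpr h)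

theorem demazureCharacter_of_lt (γ : Fin n → ℕ) {i j : Fin n} (hij : (j : ℕ) = i + 1)
    (h : γ i < γ j) :
    demazureCharacter F γ = isobaric i j (demazureCharacter F (exchange γ i j)) := by
  induction hN : ∑ a : Fin n, (a : ℕ) * γ a using Nat.strong_induction_on
    generalizing γ i j with
  | _ N ih =>
    subst hN
    have hex : ∃ p : Fin n × Fin n, (p.2 : ℕ) = p.1 + 1 ∧ γ p.1 < γ p.2 := ⟨(i, j), hij, h⟩
    rw [demazureCharacter, dif_pos hex]
    obtain ⟨hkl, h'⟩ := hex.choose_spec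
    generalize hex.choose.1 = k at *
    generalize hex.choose.2 = l at *
    -- it remains to compare the ascents `(k, l)` and `(i, j)`
    have key : ∀ {i j k l : Fin n}, (j : ℕ) = i + 1 → (l : ℕ) = k + 1 → γ i < γ j → γ k < γ l →
        i < k → isobaric k l (demazureCharacter F (exchange γ k l)) =
          isobaric i j (demazureCharacter F (exchange γ i j)) := by
      intro i j k l hij hkl h h' hik
      have lij : i < j := Fin.lt_def.mpr (by omega)
      have lkl : k < l := Fin.lt_def.mpr (by omega)
      have hjk : j ≤ k := Fin.le_def.mpr (by have := Fin.lt_def.mp hik; omega)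
      have w1 := weight_exchange_lt γ lij h
      have w2 := weight_exchange_lt γ lkl h'
      have hil : i < l := hik.trans lkl
      have hjl : j < l := hjk.trans_lt lkl
      rcases hjk.eq_or_lt with rfl | hjk
      · have a1 : exchange γ j l i = γ i :=
          congrArg γ (Equiv.swap_apply_of_ne_of_ne lij.ne hil.ne)
        have a2 : exchange γ j l j = γ l := congrArg γ (Equiv.swap_apply_left _ _)
        have a3 : exchange γ j l l = γ j := congrArg γ (Equiv.swap_apply_right _ _)
        have b1 : exchange γ i j i = γ j := congrArg γ (Equiv.swap_apply_left _ _)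
        have b2 : exchange γ i j j = γ i := congrArg γ (Equiv.swap_apply_right _ _)
        have b3 : exchange γ i j l = γ l :=
          congrArg γ (Equiv.swap_apply_of_ne_of_ne hil.ne' hjl.ne')
        have c2 : exchange (exchange γ j l) i j j = γ i :=
          (congrArg (exchange γ j l) (Equiv.swap_apply_right _ _)).trans a1
        have c3 : exchange (exchange γ j l) i j l = γ j :=
          (congrArg (exchange γ j l) (Equiv.swap_apply_of_ne_of_ne hil.ne' hjl.ne')).trans a3
        have d1 : exchange (exchange γ i j) j l i = γ j :=
          (congrArg (exchange γ i j) (Equiv.swap_apply_of_ne_of_ne lij.ne hil.ne)).trans b1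
        have d2 : exchange (exchange γ i j) j l j = γ l :=
          (congrArg (exchange γ i j) (Equiv.swap_apply_left _ _)).trans b3
        have w3 := weight_exchange_lt (exchange γ j l) lij (by rw [a1, a2]; exact h.trans h')
        have w4 := weight_exchange_lt (exchange γ i j) lkl (by rw [b2, b3]; exact h.trans h')
        rw [ih _ w2 (exchange γ j l) hij (by rw [a1, a2]; exact h.trans h') rfl,
          ih _ (w3.trans w2) (exchange (exchange γ j l) i j) hkl (by rw [c2, c3]; exact h) rfl,
          ih _ w1 (exchange γ i j) hkl (by rw [b2, b3]; exact h.trans h') rfl,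
          ih _ (w4.trans w1) (exchange (exchange γ i j) j l) hij (by rw [d1, d2]; exact h') rfl,
          isobaric_braid lij.ne hjl.ne hil.ne]
        congr 4
        funext a
        simp only [exchange, Function.comp]
        congr 1
        simp only [Equiv.swap_apply_def]
        have := lij.ne
        have := hil.ne
        have := hjl.ne
        grind
      · have a1 : exchange γ k l i = γ i :=
          congrArg γ (Equiv.swap_apply_of_ne_of_ne hik.ne hil.ne)
        have a2 : exchange γ k l j = γ j :=
          congrArg γ (Equiv.swap_apply_of_ne_of_ne hjk.ne hjl.ne)
        have b1 : exchange γ i j k = γ k :=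
          congrArg γ (Equiv.swap_apply_of_ne_of_ne hik.ne' hjk.ne')
        have b2 : exchange γ i j l = γ l :=
          congrArg γ (Equiv.swap_apply_of_ne_of_ne hil.ne' hjl.ne')
        rw [ih _ w2 (exchange γ k l) hij (by rw [a1, a2]; exact h) rfl,
          ih _ w1 (exchange γ i j) hkl (by rw [b1, b2]; exact h') rfl,
          isobaric_comm lij.ne lkl.ne hik.ne hil.ne hjk.ne hjl.ne]
        congr 3
        funext a
        simp only [exchange, Function.comp]
        congr 1
        simp only [Equiv.swap_apply_def]
        have := lij.ne
        have := lkl.ne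
        have := hik.ne
        have := hil.ne
        have := hjk.ne
        have := hjl.ne
        grind
    rcases lt_trichotomy i k with hik | rfl | hik
    · exact key hij hkl h h' hik
    · have : l = j := Fin.ext (by omega)
      rw [this]
    · exact (key hkl hij h' h hik).symm

end Demazure

/-! ### Skip compositions and the candidate basis -/

/-- For `S = {s_1 < ⋯ < s_m} ⊆ {1, …, n}`, the weak composition `γ(S)` of length `n` with
`γ_i = s_j - j + 1` if `i = s_j`, and `γ_i = 0` if `i ∉ S`. The place `i` is `⟨i - 1, _⟩`, and
`j` is the number of elements of `S` that are at most `i`. -/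
def skipComposition (n : ℕ) (S : Finset ℕ) (a : Fin n) : ℕ :=
  if (a : ℕ) + 1 ∈ S then ((a : ℕ) + 1) - (S.filter (· ≤ (a : ℕ) + 1)).card + 1 else 0

/-- The reverse `γ(S)^* = (γ_n, …, γ_1)` of `γ(S)`. -/
def reverseSkipComposition (n : ℕ) (S : Finset ℕ) (a : Fin n) : ℕ :=
  skipComposition n S a.rev

/-- The polynomials `h_k(x_1, …, x_i)` for `1 ≤ i ≤ n`, together with the Demazure characters
`κ_{γ(S)^*}` for `S ⊆ {1, …, n - 1}` with `|S| = n - k + 1`. -/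
def groebnerSet (F : Type*) [Field F] (n k : ℕ) : Set (MvPolynomial (Fin n) F) :=
  {f | ∃ (i : ℕ) (hi : i ≤ n), 1 ≤ i ∧ f = completeHomogeneous F n k i hi} ∪
    {f | ∃ S : Finset ℕ, S ⊆ Finset.Icc 1 (n - 1) ∧ S.card = n - k + 1 ∧
      f = demazureCharacter F (reverseSkipComposition n S)}


end

end ZeroHecke

/-! Three facts are needed: the candidates lie in `J_{n,k}`, their leading monomials are known, and
no nonzero element of `J_{n,k}` is supported on monomials that avoid all these leading monomials.

The first two come from flagged Jacobi–Trudi determinants with entries h_{N+j-a_i} in the first φ_i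
variables. The operator π_q turns h_d(x_1,…,x_q) into h_d(x_1,…,x_{q+1}) and is linear over
polynomials symmetric in x_q, x_{q+1}, so it raises the flag of a single row. Starting from the flag
1, 2, …, m, where the determinant is a monomial, this gives `demazureCharacter_flaggedComposition`:
the characters of reversed skip compositions are such determinants with a = φ = p. For this choice,
multiplication by a column of signed elementary polynomials puts each row into ⟨e_{n-k+1},…,e_n⟩
(`det_flaggedMatrix_mem`), and in neglex the diagonal product beats all others, so that κ_γ has
leading monomial x^γ (`det_flaggedMatrix_monic`).

The third fact compares the quotient with a finite point set Y, over an infinite extension field. By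
division, the standard monomials span modulo `J_{n,k}`. The set Y is chosen so that each generator
of `J_{n,k}` is the top homogeneous component of a polynomial vanishing on Y; hence the quotient is
at least as large as the space of functions on Y. If there are at most |Y| standard monomials, they
are therefore linearly independent modulo the ideal (`eq_zero_of_mem_of_mem_restrictSupport`). For
the inequality, a greedy search for skip patterns bounds the number of standard monomials by a count
of words; that count and |Y| obey one-step recursions whose generating series are the same product
up to a simple factor (`mul_greedyCount_eq_coveringCount`). -/

namespace ZeroHecke

noncomputable section

/-! ### Generating series of elementary and complete homogeneous polynomials -/

section Series

variable {R : Type*} [CommRing R]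

/-- The geometric series `1 / (1 - r T)`. -/
def geometricSeries (r : R) : PowerSeries R := PowerSeries.mk fun d => r ^ d

/-- The linear factor `1 - r T`. -/
def linearFactor (r : R) : PowerSeries R := 1 - PowerSeries.C r * PowerSeries.X

theorem geometricSeries_mul_linearFactor (r : R) :
    geometricSeries r * linearFactor r = 1 := by
  ext d
  rw [geometricSeries, linearFactor, mul_sub, mul_one, ← mul_assoc, map_sub]
  cases d with
  | zero => simp
  | succ d =>
    rw [PowerSeries.coeff_succ_mul_X, mul_comm, PowerSeries.coeff_C_mul]
    simp [PowerSeries.coeff_one, pow_succ']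

/-- The generating series `∏_{q < p} 1 / (1 - x_q T)` of the complete homogeneous polynomials in
`x_0, …, x_{p-1}`. -/
def hSeries (x : ℕ → R) (p : ℕ) : PowerSeries R := ∏ q ∈ Finset.range p, geometricSeries (x q)

/-- The generating series `∏_{q < p} (1 - x_q T)` of the signed elementary polynomials in
`x_0, …, x_{p-1}`. -/
def eSeries (x : ℕ → R) (p : ℕ) : PowerSeries R := ∏ q ∈ Finset.range p, linearFactor (x q)

theorem hSeries_succ (x : ℕ → R) (p : ℕ) :
    hSeries x (p + 1) = hSeries x p * geometricSeries (x p) :=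
  Finset.prod_range_succ _ _

theorem eSeries_succ (x : ℕ → R) (p : ℕ) :
    eSeries x (p + 1) = eSeries x p * linearFactor (x p) :=
  Finset.prod_range_succ _ _

theorem hSeries_mul_eSeries (x : ℕ → R) (p : ℕ) : hSeries x p * eSeries x p = 1 := by
  rw [hSeries, eSeries, ← Finset.prod_mul_distrib]
  exact Finset.prod_eq_one fun q _ => geometricSeries_mul_linearFactor _

theorem hSeries_mul_eSeries_of_le (x : ℕ → R) {p q : ℕ} (h : p ≤ q) :
    hSeries x p * eSeries x q = ∏ i ∈ Finset.Ico p q, linearFactor (x i) := by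
  rw [eSeries, ← Finset.prod_range_mul_prod_Ico _ h, ← mul_assoc]
  exact (congrArg (· * _) (hSeries_mul_eSeries x p)).trans (one_mul _)

theorem coeff_prod_linearFactor_eq_zero {ι : Type*} (s : Finset ι) (f : ι → R) {d : ℕ}
    (hd : s.card < d) : PowerSeries.coeff d (∏ i ∈ s, linearFactor (f i)) = 0 := by
  induction s using Finset.cons_induction generalizing d with
  | empty => simp only [Finset.card_empty] at hd; simp [PowerSeries.coeff_one, hd.ne']
  | cons a s ha ih =>
    rw [Finset.card_cons] at hd
    obtain ⟨d, rfl⟩ := Nat.exists_eq_succ_of_ne_zero (by omega : d ≠ 0)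
    rw [Finset.prod_cons, linearFactor, sub_mul, one_mul, mul_assoc, map_sub,
      PowerSeries.coeff_C_mul, PowerSeries.coeff_succ_X_mul, ih (by omega), ih (by omega)]
    simp

theorem coeff_zero_prod_linearFactor {ι : Type*} (s : Finset ι) (f : ι → R) :
    PowerSeries.coeff 0 (∏ i ∈ s, linearFactor (f i)) = 1 := by
  simp [linearFactor, map_prod]

theorem coeff_zero_hSeries (x : ℕ → R) (p : ℕ) : PowerSeries.coeff 0 (hSeries x p) = 1 := by
  simp [hSeries, geometricSeries, map_prod]

theorem coeff_succ_hSeries_succ (x : ℕ → R) (p d : ℕ) :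
    PowerSeries.coeff (d + 1) (hSeries x (p + 1)) =
      PowerSeries.coeff (d + 1) (hSeries x p) +
        x p * PowerSeries.coeff d (hSeries x (p + 1)) := by
  have h : hSeries x (p + 1) * linearFactor (x p) = hSeries x p := by
    rw [hSeries_succ, mul_assoc, geometricSeries_mul_linearFactor, mul_one]
  have h2 := congrArg (PowerSeries.coeff (d + 1)) h
  rw [linearFactor, mul_sub, mul_one, mul_left_comm, map_sub, PowerSeries.coeff_C_mul,
    PowerSeries.coeff_succ_mul_X] at h2
  rw [← h2, sub_add_cancel]

variable {R' : Type*} [CommRing R']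

theorem map_geometricSeries (f : R →+* R') (r : R) :
    PowerSeries.map f (geometricSeries r) = geometricSeries (f r) := by
  ext d
  simp [geometricSeries]

theorem map_linearFactor (f : R →+* R') (r : R) :
    PowerSeries.map f (linearFactor r) = linearFactor (f r) := by
  simp [linearFactor]

theorem map_hSeries (f : R →+* R') (x : ℕ → R) (p : ℕ) :
    PowerSeries.map f (hSeries x p) = hSeries (fun q => f (x q)) p := by
  simp [hSeries, map_prod, map_geometricSeries]

theorem map_eSeries (f : R →+* R') (x : ℕ → R) (p : ℕ) :
    PowerSeries.map f (eSeries x p) = eSeries (fun q => f (x q)) p := by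
  simp [eSeries, map_prod, map_linearFactor]

/-- Multisets of size d correspond to exponent vectors of sum d. This links the definition of
`hsymm` by multisets with the product of geometric series. -/
theorem sum_sym_prod_eq_coeff_hSeries (x : ℕ → R) (p d : ℕ) :
    ∑ s : Sym (Fin p) d, (s.1.map fun i : Fin p => x i).prod =
      PowerSeries.coeff d (hSeries x p) := by
  have h : hSeries x p = ∏ i : Fin p, geometricSeries (x i) :=
    (Fin.prod_univ_eq_prod_range (fun q => geometricSeries (x q)) p).symm
  rw [h, PowerSeries.coeff_prod]
  simp only [geometricSeries, PowerSeries.coeff_mk]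
  refine Finset.sum_bij' (fun s _ => Multiset.toFinsupp s.1)
    (fun l hl => (⟨Finsupp.toMultiset l, ?_⟩ : Sym (Fin p) d)) ?_ ?_ ?_ ?_ ?_
  · rw [Finset.mem_finsuppAntidiag] at hl
    rw [Finsupp.card_toMultiset, Finsupp.sum_fintype _ _ (fun _ => rfl)]
    exact hl.1
  · intro s _
    rw [Finset.mem_finsuppAntidiag]
    refine ⟨?_, Finset.subset_univ _⟩
    change ∑ i, Multiset.count i s.1 = d
    rw [Multiset.sum_count_eq_card (fun _ _ => Finset.mem_univ _)]
    exact s.2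
  · intro l hl
    exact Finset.mem_univ _
  · intro s _
    exact Subtype.ext (by simp)
  · intro l hl
    simp
  · intro s _
    rw [Finset.prod_multiset_map_count]
    refine Finset.prod_subset (Finset.subset_univ _) fun i _ hi => ?_
    rw [Multiset.mem_toFinset] at hi
    rw [Multiset.count_eq_zero_of_notMem hi, pow_zero]

end Series

/-! ### Series over the polynomial ring -/

section Variables

variable {n : ℕ} {F : Type*} [Field F]

/-- The sequence of the variables, continued by zeros. -/
def varSeq (F : Type*) [Field F] (n : ℕ) (q : ℕ) : MvPolynomial (Fin n) F :=
  if h : q < n then X ⟨q, h⟩ else 0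

theorem varSeq_val (i : Fin n) : varSeq F n i = X i := by
  simp [varSeq]

theorem varSeq_of_lt {q : ℕ} (h : q < n) : varSeq F n q = X ⟨q, h⟩ := dif_pos h

theorem completeHomogeneous_eq_coeff (d p : ℕ) (hp : p ≤ n) :
    completeHomogeneous F n d p hp = PowerSeries.coeff d (hSeries (varSeq F n) p) := by
  rw [← sum_sym_prod_eq_coeff_hSeries, completeHomogeneous, hsymm, map_sum]
  refine Finset.sum_congr rfl fun s _ => ?_
  rw [map_multiset_prod, Multiset.map_map]
  congr 2
  funext i
  rw [Function.comp, rename_X, varSeq_of_lt (i.2.trans_le hp)]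
  rfl

theorem coeff_eSeries_varSeq (v : ℕ) :
    PowerSeries.coeff v (eSeries (varSeq F n) n) = (-1) ^ v * esymm (Fin n) F v := by
  have h : eSeries (varSeq F n) n =
      ∏ i : Fin n, (1 + PowerSeries.C (-X i : MvPolynomial (Fin n) F) * PowerSeries.X) := by
    rw [eSeries, ← Fin.prod_univ_eq_prod_range (fun q => linearFactor (varSeq F n q)) n]
    refine Finset.prod_congr rfl fun i _ => ?_
    rw [varSeq_val, linearFactor, map_neg, neg_mul, sub_eq_add_neg]
  have h2 : ∀ t : Finset (Fin n), PowerSeries.coeff v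
      (∏ i ∈ t, PowerSeries.C (-X i : MvPolynomial (Fin n) F) * PowerSeries.X) =
        if t.card = v then (-1) ^ v * ∏ i ∈ t, X i else 0 := by
    intro t
    rw [Finset.prod_mul_distrib, Finset.prod_const, ← map_prod, PowerSeries.coeff_C_mul,
      PowerSeries.coeff_X_pow, Finset.prod_neg]
    by_cases hv : t.card = v
    · simp [hv]
    · simp [hv, Ne.symm hv]
  rw [h, Finset.prod_one_add, map_sum, esymm, Finset.mul_sum, Finset.powersetCard_eq_filter,
    Finset.sum_filter]
  exact Finset.sum_congr rfl fun t _ => h2 t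

end Variables

/-! ### Flagged Jacobi–Trudi determinants -/

section Determinant

variable {R : Type*} [CommRing R] {m : ℕ}

/-- The matrix with entries `h_{N + j - a_i}(x_0, …, x_{φ_i - 1})`. -/
def flaggedMatrix (x : ℕ → R) (N : ℕ) (a φ : Fin m → ℕ) : Matrix (Fin m) (Fin m) R :=
  Matrix.of fun i j =>
    PowerSeries.coeff (N + j) (PowerSeries.X ^ a i * hSeries x (φ i))

theorem flaggedMatrix_apply (x : ℕ → R) (N : ℕ) (a φ : Fin m → ℕ) (i j : Fin m) :
    flaggedMatrix x N a φ i j =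
      PowerSeries.coeff (N + j) (PowerSeries.X ^ a i * hSeries x (φ i)) := rfl

/-- A product with a polynomial of degree at most `l`, expanded at the index `N + l`. -/
theorem coeff_mul_eq_sum_fin {G D : PowerSeries R} {N : ℕ} (l : Fin m)
    (hD : ∀ v, (l : ℕ) < v → PowerSeries.coeff v D = 0) :
    PowerSeries.coeff (N + l) (G * D) = ∑ j : Fin m, PowerSeries.coeff (N + j) G *
      if j ≤ l then PowerSeries.coeff (l - j) D else 0 := by
  rw [PowerSeries.coeff_mul]
  symm
  simp only [mul_ite, mul_zero]
  rw [← Finset.sum_filter]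
  refine Finset.sum_of_injOn (fun j : Fin m => (N + (j : ℕ), (l : ℕ) - j)) ?_ ?_ ?_ ?_
  · intro i _ j _ h
    simp only [Prod.mk.injEq] at h
    exact Fin.ext (by omega)
  · intro j hj
    simp only [Finset.coe_filter, Set.mem_ofPred_eq, Fin.le_def] at hj
    rw [Finset.mem_coe, Finset.HasAntidiagonal.mem_antidiagonal]
    dsimp only
    omega
  · rintro ⟨u, v⟩ huv h
    rw [Finset.HasAntidiagonal.mem_antidiagonal] at huv
    by_cases hv : (l : ℕ) < v
    · simp [hD v hv]
    · exfalso
      apply h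
      simp only at huv
      refine ⟨⟨u - N, by omega⟩, ?_, ?_⟩
      · simp only [Finset.coe_filter, Set.mem_ofPred_eq, Fin.le_def, Finset.mem_univ, true_and]
        omega
      · simp only [Prod.mk.injEq]
        omega
  · intro j _
    rfl

/-- Multiplication by the unitriangular matrix whose column l holds the coefficients of `eSeries x
l` makes the (i, l) entry the coefficient of T^(N+l-a_i) in H_{i+1} E_l. For i < l that product is a
polynomial of degree at most l-i-1, too small; for i = l it is the geometric series of x_i. So the
product is lower triangular with the stated diagonal. -/
theorem det_flaggedMatrix_of_flag_eq_succ (x : ℕ → R) (N : ℕ) (a : Fin m → ℕ)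
    (ha : ∀ i, a i ≤ N + i) :
    (flaggedMatrix x N a fun i => i + 1).det = ∏ i : Fin m, x i ^ (N + i - a i) := by
  set U : Matrix (Fin m) (Fin m) R := Matrix.of fun j l =>
    if j ≤ l then PowerSeries.coeff (l - j) (eSeries x l) else 0 with hU
  have hUdet : U.det = 1 := by
    rw [Matrix.det_of_isUpperTriangular]
    · refine Finset.prod_eq_one fun i _ => ?_
      simp only [hU, Matrix.of_apply, le_refl, if_true, Nat.sub_self]
      exact coeff_zero_prod_linearFactor _ _
    · intro i j hij
      simp only [hU, Matrix.of_apply]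
      exact if_neg (not_le.mpr hij)
  have hmul : ∀ i l, (flaggedMatrix x N a (fun i => i + 1) * U) i l =
      PowerSeries.coeff (N + l) (PowerSeries.X ^ a i * (hSeries x (i + 1) * eSeries x l)) := by
    intro i l
    rw [← mul_assoc, coeff_mul_eq_sum_fin l, Matrix.mul_apply]
    · rfl
    · intro v hv
      exact coeff_prod_linearFactor_eq_zero _ _ (by rwa [Finset.card_range])
  rw [← mul_one (Matrix.det _), ← hUdet, ← Matrix.det_mul, Matrix.det_of_isLowerTriangular]
  · refine Finset.prod_congr rfl fun i _ => ?_
    rw [hmul, hSeries_succ, mul_right_comm, hSeries_mul_eSeries, one_mul,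
      PowerSeries.coeff_X_pow_mul', if_pos (ha i), geometricSeries, PowerSeries.coeff_mk]
  · intro i l hil
    have hil' : (i : ℕ) < l := hil
    rw [hmul, hSeries_mul_eSeries_of_le x (Nat.succ_le_of_lt hil'),
      PowerSeries.coeff_X_pow_mul', if_pos ((ha i).trans (by omega))]
    refine coeff_prod_linearFactor_eq_zero _ _ ?_
    have := ha i
    rw [Nat.card_Ico]
    omega

end Determinant

/-! ### Demazure characters as flagged determinants -/

section Character

variable {n m : ℕ} {F : Type*} [Field F]

theorem rename_swap_varSeq_left {q : ℕ} (hq : q + 1 < n) :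
    rename (Equiv.swap (⟨q, by omega⟩ : Fin n) ⟨q + 1, hq⟩) (varSeq F n q) =
      varSeq F n (q + 1) := by
  rw [varSeq_of_lt (by omega : q < n), varSeq_of_lt hq, rename_X, Equiv.swap_apply_left]

theorem rename_swap_varSeq_right {q : ℕ} (hq : q + 1 < n) :
    rename (Equiv.swap (⟨q, by omega⟩ : Fin n) ⟨q + 1, hq⟩) (varSeq F n (q + 1)) =
      varSeq F n q := by
  rw [varSeq_of_lt (by omega : q < n), varSeq_of_lt hq, rename_X, Equiv.swap_apply_right]

theorem rename_swap_varSeq_of_ne {q r : ℕ} (hq : q + 1 < n) (h1 : r ≠ q) (h2 : r ≠ q + 1) :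
    rename (Equiv.swap (⟨q, by omega⟩ : Fin n) ⟨q + 1, hq⟩) (varSeq F n r) = varSeq F n r := by
  by_cases hr : r < n
  · rw [varSeq_of_lt hr, rename_X, Equiv.swap_apply_of_ne_of_ne] <;>
      simp only [ne_eq, Fin.mk.injEq] <;> assumption
  · simp [varSeq, hr]

/-- The action of the exchange of `x_q` and `x_{q+1}` on power series. -/
def swapSeries {q : ℕ} (hq : q + 1 < n) :
    PowerSeries (MvPolynomial (Fin n) F) →+* PowerSeries (MvPolynomial (Fin n) F) :=
  PowerSeries.map
    (rename (Equiv.swap (⟨q, by omega⟩ : Fin n) ⟨q + 1, hq⟩) :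
      MvPolynomial (Fin n) F →ₐ[F] MvPolynomial (Fin n) F).toRingHom

theorem swapSeries_hSeries_of_le {q p : ℕ} (hq : q + 1 < n) (hp : p ≤ q) :
    swapSeries hq (hSeries (varSeq F n) p) = hSeries (varSeq F n) p := by
  rw [swapSeries, map_hSeries, hSeries, hSeries]
  refine Finset.prod_congr rfl fun r hr => ?_
  rw [Finset.mem_range] at hr
  exact congrArg _ (rename_swap_varSeq_of_ne hq (by omega) (by omega))

theorem swapSeries_hSeries_succ {q : ℕ} (hq : q + 1 < n) :
    swapSeries hq (hSeries (varSeq F n) (q + 1)) =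
      hSeries (varSeq F n) q * geometricSeries (varSeq F n (q + 1)) := by
  rw [hSeries_succ, map_mul, swapSeries_hSeries_of_le hq le_rfl, swapSeries,
    map_geometricSeries]
  exact congrArg (fun t => _ * geometricSeries t) (rename_swap_varSeq_left hq)

theorem swapSeries_hSeries_of_lt {q p : ℕ} (hq : q + 1 < n) (hp : q + 1 < p) :
    swapSeries hq (hSeries (varSeq F n) p) = hSeries (varSeq F n) p := by
  induction p, hp using Nat.le_induction with
  | base =>
    rw [hSeries_succ, map_mul, swapSeries_hSeries_succ, hSeries_succ, swapSeries,
      map_geometricSeries, mul_right_comm]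
    exact congrArg (fun t => _ * geometricSeries t * _) (rename_swap_varSeq_right hq)
  | succ p hp ih =>
    rw [hSeries_succ, map_mul, ih, swapSeries, map_geometricSeries]
    exact congrArg (fun t => _ * geometricSeries t)
      (rename_swap_varSeq_of_ne hq (by omega) (by omega))

/-- After removal of the common factor H_q this is x/(1-xT) - y/(1-yT) = (x-y)/((1-xT)(1-yT)). It
says, in all degrees at once, that the Demazure operator adds one variable to a complete homogeneous
polynomial. -/
theorem hSeries_exchange {q : ℕ} (hq : q + 1 < n) :
    PowerSeries.C (varSeq F n q - varSeq F n (q + 1)) * hSeries (varSeq F n) (q + 2) =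
      PowerSeries.C (varSeq F n q) * hSeries (varSeq F n) (q + 1) -
        PowerSeries.C (varSeq F n (q + 1)) *
          swapSeries hq (hSeries (varSeq F n) (q + 1)) := by
  rw [swapSeries_hSeries_succ, hSeries_succ, hSeries_succ]
  have h1 := geometricSeries_mul_linearFactor (varSeq F n q)
  have h2 := geometricSeries_mul_linearFactor (varSeq F n (q + 1))
  simp only [linearFactor] at h1 h2
  rw [map_sub]
  linear_combination hSeries (varSeq F n) q *
    (PowerSeries.C (varSeq F n q) * geometricSeries (varSeq F n q) * h2
      - PowerSeries.C (varSeq F n (q + 1)) * geometricSeries (varSeq F n (q + 1)) * h1)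

/-- No row other than i has flag q+1, so each of them involves both or neither of x_q, x_{q+1}, and
is symmetric in them. The operator therefore acts on row i alone, by `hSeries_exchange` and
multilinearity. -/
theorem isobaric_det_flaggedMatrix (N : ℕ) (a φ : Fin m → ℕ) (i : Fin m) {q : ℕ}
    (hq : q + 1 < n) (hi : φ i = q + 2) (hφ : ∀ j, j ≠ i → φ j ≠ q + 1) :
    isobaric ⟨q, by omega⟩ ⟨q + 1, hq⟩
        (flaggedMatrix (varSeq F n) N a (Function.update φ i (q + 1))).det =
      (flaggedMatrix (varSeq F n) N a φ).det := by
  symm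
  have hne : (⟨q, by omega⟩ : Fin n) ≠ ⟨q + 1, hq⟩ := by simp
  apply isobaric_unique hne
  set s := (rename (Equiv.swap (⟨q, by omega⟩ : Fin n) ⟨q + 1, hq⟩) :
      MvPolynomial (Fin n) F →ₐ[F] MvPolynomial (Fin n) F).toRingHom with hs
  set M := flaggedMatrix (varSeq F n) N a φ with hM
  set M' := flaggedMatrix (varSeq F n) N a (Function.update φ i (q + 1)) with hM'
  have e1 : M' = M.updateRow i (M' i) := by
    ext j l
    by_cases hj : j = i
    · subst hj; simp
    · simp [hj, hM, hM', flaggedMatrix_apply]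
  have hsM : ∀ j l, (M'.map s) j l = PowerSeries.coeff (N + l)
      (PowerSeries.X ^ a j *
        swapSeries hq (hSeries (varSeq F n) (Function.update φ i (q + 1) j))) := by
    intro j l
    rw [Matrix.map_apply, hM', flaggedMatrix_apply, swapSeries, ← hs, ← PowerSeries.coeff_map,
      map_mul, map_pow, PowerSeries.map_X]
  have e2 : M'.map s = M.updateRow i ((M'.map s) i) := by
    ext j l
    by_cases hj : j = i
    · subst hj; simp
    · rw [Matrix.updateRow_ne hj, hsM, hM, flaggedMatrix_apply, Function.update_of_ne hj]
      rcases lt_or_gt_of_ne (hφ j hj) with h | h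
      · rw [swapSeries_hSeries_of_le hq (by omega)]
      · rw [swapSeries_hSeries_of_lt hq (by omega)]
  have hrow : (varSeq F n q - varSeq F n (q + 1)) • M i =
      varSeq F n q • M' i + (-varSeq F n (q + 1)) • (M'.map s) i := by
    ext1 l
    simp only [Pi.smul_apply, Pi.add_apply, smul_eq_mul]
    rw [hsM, hM, hM', flaggedMatrix_apply, flaggedMatrix_apply, Function.update_self, hi,
      ← PowerSeries.coeff_C_mul, ← PowerSeries.coeff_C_mul, ← PowerSeries.coeff_C_mul, ← map_add,
      mul_left_comm, hSeries_exchange hq, map_neg]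
    congr 1
    ring
  have hdet : s M'.det = (M'.map s).det := RingHom.map_det s M'
  have key : (varSeq F n q - varSeq F n (q + 1)) * M.det =
      varSeq F n q * M'.det - varSeq F n (q + 1) * s M'.det := by
    rw [hdet]
    conv_lhs => rw [← Matrix.updateRow_eq_self M i]
    rw [← Matrix.det_updateRow_smul, hrow, Matrix.det_updateRow_add,
      Matrix.det_updateRow_smul, Matrix.det_updateRow_smul, ← e1, ← e2]
    ring
  rw [varSeq_of_lt hq, varSeq_of_lt (by omega : q < n)] at key
  exact key

/-- The weak composition with the entry `N + i - a_i` in the place `φ_i` (counted from `1`) and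
zeros elsewhere. -/
def flaggedComposition (n N : ℕ) (a φ : Fin m → ℕ) (q : Fin n) : ℕ :=
  ∑ i : Fin m, if φ i = q + 1 then N + i - a i else 0

theorem flaggedComposition_of_eq {N : ℕ} {a φ : Fin m → ℕ} (hφ : Function.Injective φ)
    {q : Fin n} {i : Fin m} (h : φ i = q + 1) :
    flaggedComposition n N a φ q = N + i - a i := by
  rw [flaggedComposition, Finset.sum_eq_single i]
  · rw [if_pos h]
  · intro j _ hj
    exact if_neg fun h' => hj (hφ (h'.trans h.symm))
  · simp

theorem flaggedComposition_of_ne {N : ℕ} {a φ : Fin m → ℕ} {q : Fin n}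
    (h : ∀ i, φ i ≠ q + 1) : flaggedComposition n N a φ q = 0 :=
  Finset.sum_eq_zero fun i _ => if_neg (h i)

/-- The size N+i-a_i of an entry does not involve φ, which only decides where it sits; lowering φ_i
into a free place just moves the entry one place to the left. -/
theorem flaggedComposition_update {N : ℕ} {a φ : Fin m → ℕ} (hφ : Function.Injective φ)
    (i : Fin m) {q : ℕ} (hq : q + 1 < n) (hi : φ i = q + 2) (hne : ∀ j, φ j ≠ q + 1) :
    exchange (flaggedComposition n N a φ) ⟨q, by omega⟩ ⟨q + 1, hq⟩ =
      flaggedComposition n N a (Function.update φ i (q + 1)) := by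
  funext r
  simp only [exchange, Function.comp, flaggedComposition]
  refine Finset.sum_congr rfl fun j _ => ?_
  congr 1
  rw [eq_iff_iff]
  by_cases hj : j = i
  · subst hj
    rw [Function.update_self, hi, Equiv.swap_apply_def]
    split_ifs with h1 h2 <;> simp_all [Fin.ext_iff]
    omega
  · have h1 : φ j ≠ q + 2 := fun h => hj (hφ (h.trans hi.symm))
    have h2 := hne j
    rw [Function.update_of_ne hj, Equiv.swap_apply_def]
    split_ifs with h3 h4 <;> simp_all [Fin.ext_iff]

/-- Induction on the sum of the flag. If φ_i = i+1 throughout, the composition is weakly decreasing,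
since a is strictly increasing, and both sides are the same monomial. Otherwise the first φ_i that
is too large can be lowered by one: on the left this undoes an ascent from 0 to N+i-a_i, on the
right it undoes a Demazure operator. The parameters a and φ, equal in the application, are kept
apart because only φ moves in the induction. -/
theorem demazureCharacter_flaggedComposition (N : ℕ) (a : Fin m → ℕ) (ha : StrictMono a)
    (haN : ∀ i, a i < N + i) (φ : Fin m → ℕ) (hφ : StrictMono φ) (h0 : ∀ i, 0 < φ i)
    (hn : ∀ i, φ i ≤ n) :
    demazureCharacter F (flaggedComposition n N a φ) =
      (flaggedMatrix (varSeq F n) N a φ).det := by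
  induction hk : ∑ i, φ i using Nat.strong_induction_on generalizing φ with
  | _ k ih =>
  subst hk
  by_cases hall : ∀ i, φ i = i + 1
  · obtain rfl : φ = fun i : Fin m => (i : ℕ) + 1 := funext hall
    have hval : ∀ q : Fin n, ∀ h : (q : ℕ) < m,
        flaggedComposition n N a (fun i : Fin m => (i : ℕ) + 1) q = N + q - a ⟨q, h⟩ := fun q h =>
      flaggedComposition_of_eq (φ := fun i : Fin m => (i : ℕ) + 1) hφ.injective
        (i := ⟨q, h⟩) rfl
    have hval0 : ∀ q : Fin n, m ≤ (q : ℕ) →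
        flaggedComposition n N a (fun i : Fin m => (i : ℕ) + 1) q = 0 := fun q h =>
      flaggedComposition_of_ne fun i => by have := i.2; omega
    have hmono : ∀ (d i : ℕ) (h : i + d < m), a ⟨i, by omega⟩ + d ≤ a ⟨i + d, h⟩ := by
      intro d
      induction d with
      | zero => intro i h; simp
      | succ d ihd =>
        intro i h
        have h1 := ihd i (by omega)
        have h2 : a ⟨i + d, by omega⟩ < a ⟨i + (d + 1), h⟩ := ha (by simp [Fin.lt_def])
        omega
    have hanti : Antitone (flaggedComposition n N a fun i : Fin m => (i : ℕ) + 1) := by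
      intro q r hqr
      have hqr' : (q : ℕ) ≤ r := hqr
      by_cases hr : (r : ℕ) < m
      · rw [hval r hr, hval q (by omega)]
        have := hmono (r - q) q (by omega)
        have e : (⟨(q : ℕ) + (r - q), by omega⟩ : Fin m) = ⟨r, hr⟩ := Fin.ext (by simp; omega)
        rw [e] at this
        omega
      · rw [hval0 r (by omega)]
        exact Nat.zero_le _
    rw [demazureCharacter_of_antitone hanti,
      det_flaggedMatrix_of_flag_eq_succ _ _ _ fun i => (haN i).le, monomial_eq, map_one, one_mul,
      Finsupp.prod_fintype _ _ fun _ => pow_zero _]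
    have hmn : ∀ i : Fin m, (i : ℕ) < n := fun i => hn i
    symm
    refine Finset.prod_of_injOn (fun i : Fin m => (⟨i, hmn i⟩ : Fin n)) ?_ ?_ ?_ ?_
    · intro i _ j _ h
      simpa [Fin.ext_iff] using h
    · intro i _
      simp
    · intro q _ hq
      rw [Finsupp.equivFunOnFinite_symm_apply_apply, hval0 q, pow_zero]
      by_contra h
      exact hq ⟨⟨q, by omega⟩, by simp⟩
    · intro i _
      rw [Finsupp.equivFunOnFinite_symm_apply_apply, hval _ i.2, varSeq_of_lt (hmn i)]
  · push Not at hall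
    obtain ⟨t, hlt, hne, hmin⟩ : ∃ (t : ℕ) (h : t < m), φ ⟨t, h⟩ ≠ t + 1 ∧
        ∀ j : Fin m, (j : ℕ) < t → φ j = j + 1 := by
      classical
      have hex : ∃ t : ℕ, ∃ h : t < m, φ ⟨t, h⟩ ≠ t + 1 := by
        obtain ⟨i, hi⟩ := hall
        exact ⟨i, i.2, hi⟩
      obtain ⟨hlt, hne⟩ := Nat.find_spec hex
      refine ⟨_, hlt, hne, fun j hj => ?_⟩
      by_contra h
      exact Nat.find_min hex hj ⟨j.2, h⟩
    set i : Fin m := ⟨t, hlt⟩ with hi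
    have hgt : (i : ℕ) + 1 < φ i := by
      have : (i : ℕ) < φ i := by
        rcases Nat.eq_zero_or_pos t with h | h
        · subst h
          exact h0 i
        · have h1 := hmin ⟨t - 1, by omega⟩ (Nat.sub_lt h one_pos)
          have h2 : φ ⟨t - 1, by omega⟩ < φ i := hφ (Nat.sub_lt h one_pos)
          simp only at h1
          change t < φ i
          omega
      have h3 : φ i ≠ i + 1 := hne
      omega
    obtain ⟨q, hq⟩ : ∃ q, φ i = q + 2 := ⟨φ i - 2, by omega⟩
    have hqn : q + 1 < n := by have := hn i; omega
    -- Rows before i have φ_j = j+1 ≤ i < q+1, and rows after i have φ_j > q+2, so the place just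
    -- below φ_i is free.
    have hnot : ∀ j, φ j ≠ q + 1 := by
      intro j
      rcases lt_trichotomy j i with h | h | h
      · have := hmin j h
        have : (j : ℕ) < i := h
        omega
      · subst h; omega
      · have := hφ h
        omega
    have c1 : flaggedComposition n N a φ ⟨q, by omega⟩ = 0 := flaggedComposition_of_ne hnot
    have c2 : flaggedComposition n N a φ ⟨q + 1, hqn⟩ = N + i - a i :=
      flaggedComposition_of_eq hφ.injective hq
    rw [demazureCharacter_of_lt (flaggedComposition n N a φ) (i := ⟨q, by omega⟩)
      (j := ⟨q + 1, hqn⟩) rfl (by rw [c1, c2]; have := haN i; omega),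
      flaggedComposition_update hφ.injective i hqn hq hnot,
      ih _ _ (Function.update φ i (q + 1)) _ _ _ rfl,
      isobaric_det_flaggedMatrix N a φ i hqn hq fun j _ => hnot j]
    · refine Finset.sum_lt_sum (fun j _ => ?_) ⟨i, Finset.mem_univ _, ?_⟩
      · by_cases hj : j = i
        · subst hj; rw [Function.update_self]; omega
        · rw [Function.update_of_ne hj]
      · rw [Function.update_self]; omega
    · intro j l hjl
      have hlt' := hφ hjl
      by_cases hl : l = i
      · subst hl
        rw [Function.update_self, Function.update_of_ne hjl.ne]
        have := hnot j
        omega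
      · by_cases hj : j = i
        · subst hj
          rw [Function.update_self, Function.update_of_ne hl]
          omega
        · rwa [Function.update_of_ne hl, Function.update_of_ne hj]
    · intro j
      by_cases hj : j = i
      · subst hj; rw [Function.update_self]; omega
      · rw [Function.update_of_ne hj]; exact h0 j
    · intro j
      by_cases hj : j = i
      · subst hj; rw [Function.update_self]; omega
      · rw [Function.update_of_ne hj]; exact hn j

end Character

/-! ### Membership of the determinants -/

section Membership

variable {n m : ℕ} {F : Type*} [Field F]

/-- Cramer: adj(A) A v = det(A) v, read off in the coordinate where v is 1. -/
theorem det_mem_of_mulVec_mem {R : Type*} [CommRing R] (I : Ideal R) (A : Matrix (Fin m) (Fin m) R)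
    (v : Fin m → R) (j : Fin m) (hj : v j = 1) (h : ∀ i, A.mulVec v i ∈ I) : A.det ∈ I := by
  have h1 : A.adjugate.mulVec (A.mulVec v) j = A.det := by
    rw [Matrix.mulVec_mulVec, Matrix.adjugate_mul, Matrix.smul_mulVec, Matrix.one_mulVec,
      Pi.smul_apply, hj, smul_eq_mul, mul_one]
  rw [← h1, Matrix.mulVec, dotProduct]
  exact I.sum_mem fun i _ => I.mul_mem_left _ (h i)

/-- The series T^{p_i} H_{p_i} E_n is a polynomial of degree at most n, so its coefficient at n+1
vanishes. That coefficient is a convolution: the terms with u ≥ k+1 form row i of the matrix applied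
to the vector of signed e_{m-1-j}, whose last entry is 1, and the terms with u ≤ k contain e_{n+1-u}
with n+1-u ≥ m. The shift N = k+1 and the choice a = φ = p serve to make this split work. -/
theorem det_flaggedMatrix_mem {k : ℕ} (hm : 0 < m) (hkn : k + m = n + 1)
    (I : Ideal (MvPolynomial (Fin n) F))
    (hI : ∀ d, m ≤ d → d ≤ n → esymm (Fin n) F d ∈ I) (p : Fin m → ℕ) (hp : ∀ i, p i ≤ n) :
    (flaggedMatrix (varSeq F n) (k + 1) p p).det ∈ I := by
  refine det_mem_of_mulVec_mem I _
    (fun j => PowerSeries.coeff (m - 1 - j) (eSeries (varSeq F n) n)) ⟨m - 1, by omega⟩ ?_ ?_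
  · simp only [Nat.sub_self]
    exact coeff_zero_prod_linearFactor _ _
  · intro i
    set G := PowerSeries.X ^ p i * hSeries (varSeq F n) (p i)
    set D := eSeries (varSeq F n) n
    have h0 : PowerSeries.coeff (n + 1) (G * D) = 0 := by
      rw [mul_assoc, hSeries_mul_eSeries_of_le _ (hp i), PowerSeries.coeff_X_pow_mul',
        if_pos ((hp i).trans n.le_succ)]
      refine coeff_prod_linearFactor_eq_zero _ _ ?_
      have := hp i
      rw [Nat.card_Ico]
      omega
    rw [PowerSeries.coeff_mul, Finset.Nat.sum_antidiagonal_eq_sum_range_succ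
      (fun u v => PowerSeries.coeff u G * PowerSeries.coeff v D),
      ← Finset.sum_range_add_sum_Ico _ (by omega : k + 1 ≤ (n + 1).succ)] at h0
    have h1 : (flaggedMatrix (varSeq F n) (k + 1) p p).mulVec
        (fun j => PowerSeries.coeff (m - 1 - j) D) i =
          ∑ u ∈ Finset.Ico (k + 1) (n + 1).succ,
            PowerSeries.coeff u G * PowerSeries.coeff (n + 1 - u) D := by
      rw [Finset.sum_Ico_eq_sum_range, (by omega : (n + 1).succ - (k + 1) = m),
        ← Fin.sum_univ_eq_sum_range (fun j => PowerSeries.coeff (k + 1 + j) G *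
          PowerSeries.coeff (n + 1 - (k + 1 + j)) D), Matrix.mulVec, dotProduct]
      refine Finset.sum_congr rfl fun j _ => ?_
      rw [flaggedMatrix_apply, (by omega : n + 1 - (k + 1 + (j : ℕ)) = m - 1 - j)]
    rw [h1, eq_neg_of_add_eq_zero_right h0]
    refine I.neg_mem (I.sum_mem fun u hu => I.mul_mem_left _ ?_)
    rw [Finset.mem_range] at hu
    -- The term u = 0 involves e_{n+1}, which is outside the range of `hI` but is zero.
    rcases Nat.eq_zero_or_pos u with rfl | hu0
    · rw [Nat.sub_zero]
      have h2 : PowerSeries.coeff (n + 1) D = 0 :=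
        coeff_prod_linearFactor_eq_zero (Finset.range n) _ (by simp)
      rw [h2]
      exact I.zero_mem
    · rw [coeff_eSeries_varSeq]
      exact I.mul_mem_left _ (hI _ (by omega) (by omega))

end Membership

/-! ### Leading monomials -/

section Leading

variable {n m : ℕ} {F : Type*} [Field F]

theorem monic_and_degree_eq_of_coeff {σ R : Type*} [CommRing R] [Nontrivial R]
    (o : MonomialOrder σ) {f : MvPolynomial σ R} {E : σ →₀ ℕ} (h1 : f.coeff E = 1)
    (h2 : ∀ c, o.toSyn E < o.toSyn c → f.coeff c = 0) : o.Monic f ∧ o.degree f = E := by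
  have hE : E ∈ f.support := by rw [mem_support_iff, h1]; exact one_ne_zero
  have hd : o.degree f = E := by
    apply o.toSyn.injective
    refine le_antisymm ?_ (o.le_degree hE)
    rw [o.degree_le_iff]
    intro c hc
    by_contra h
    exact mem_support_iff.mp hc (h2 c (not_le.mp h))
  exact ⟨by rw [MonomialOrder.Monic, MonomialOrder.leadingCoeff, hd, h1], hd⟩

theorem single_lt_single_neglex {p q : Fin n} (hpq : p < q) {c d : ℕ} (hd : 0 < d) :
    (neglex n).toSyn (Finsupp.single p c) < (neglex n).toSyn (Finsupp.single q d) := by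
  rw [neglex_lt_iff]
  refine ⟨q, fun i hi => ?_, ?_⟩
  · rw [Finsupp.single_eq_of_ne (hpq.trans hi).ne', Finsupp.single_eq_of_ne hi.ne']
  · rw [Finsupp.single_eq_of_ne hpq.ne', Finsupp.single_eq_same]
    exact hd

theorem coeff_hSeries_monic (p : ℕ) (hp : p < n) (d : ℕ) :
    (neglex n).Monic (PowerSeries.coeff d (hSeries (varSeq F n) (p + 1))) ∧
      (neglex n).degree (PowerSeries.coeff d (hSeries (varSeq F n) (p + 1))) =
        Finsupp.single ⟨p, hp⟩ d := by
  induction p generalizing d with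
  | zero =>
    have h : PowerSeries.coeff d (hSeries (varSeq F n) 1) =
        monomial (Finsupp.single ⟨0, hp⟩ d) 1 := by
      rw [hSeries, Finset.prod_range_one, geometricSeries, PowerSeries.coeff_mk,
        varSeq_of_lt hp, X_pow_eq_monomial]
    rw [h]
    classical
    exact ⟨(neglex n).monic_monomial_one, by rw [MonomialOrder.degree_monomial, if_neg one_ne_zero]⟩
  | succ p ih =>
    induction d with
    | zero =>
      rw [coeff_zero_hSeries, Finsupp.single_zero]
      exact ⟨MonomialOrder.monic_one, MonomialOrder.degree_one⟩
    | succ d ihd =>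
      rw [coeff_succ_hSeries_succ, varSeq_of_lt hp, add_comm]
      obtain ⟨hm, hdeg⟩ := ihd
      have hX : (neglex n).Monic (X ⟨p + 1, hp⟩ *
          PowerSeries.coeff d (hSeries (varSeq F n) (p + 1 + 1))) :=
        MonomialOrder.monic_X.mul hm
      have hXd : (neglex n).degree (X ⟨p + 1, hp⟩ *
          PowerSeries.coeff d (hSeries (varSeq F n) (p + 1 + 1))) =
            Finsupp.single ⟨p + 1, hp⟩ (d + 1) := by
        rw [MonomialOrder.degree_mul (X_ne_zero _) hm.ne_zero, hdeg,
          MonomialOrder.degree_X, ← Finsupp.single_add, Nat.add_comm 1 d]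
      have hlt : (neglex n).toSyn ((neglex n).degree
          (PowerSeries.coeff (d + 1) (hSeries (varSeq F n) (p + 1)))) <
            (neglex n).toSyn ((neglex n).degree (X ⟨p + 1, hp⟩ *
              PowerSeries.coeff d (hSeries (varSeq F n) (p + 1 + 1)))) := by
        rw [hXd, (ih (by omega) (d + 1)).2]
        exact single_lt_single_neglex (by simp [Fin.lt_def]) d.succ_pos
      exact ⟨hX.add_of_lt hlt, by rw [MonomialOrder.degree_add_of_lt hlt, hXd]⟩

/-- The largest moved point can only go down, as everything above it is fixed. It is the place that
decides comparisons in neglex. -/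
theorem perm_exists_last_moved (σ : Equiv.Perm (Fin m)) (hσ : σ ≠ 1) :
    ∃ i, σ i < i ∧ ∀ j, i < j → σ j = j := by
  have hne : (Finset.univ.filter fun i => σ i ≠ i).Nonempty := by
    by_contra h
    rw [Finset.not_nonempty_iff_eq_empty, Finset.filter_eq_empty_iff] at h
    exact hσ (Equiv.ext fun i => by simpa using h (Finset.mem_univ i))
  have hmax := Finset.max'_mem _ hne
  set i := Finset.max' _ hne
  have habove : ∀ j, i < j → σ j = j := by
    intro j hj
    by_contra h
    exact absurd (Finset.le_max' _ j (by simpa using h)) (not_le.mpr hj)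
  refine ⟨i, ?_, habove⟩
  rw [Finset.mem_filter] at hmax
  refine lt_of_le_of_ne (not_lt.mp fun h => ?_) hmax.2
  exact h.ne' (σ.injective (habove _ h))

/-- The exponent vector of the monomial `∏ x_{p_i - 1} ^ (N + τ_i - p_i)`. -/
def rowExponent (n N : ℕ) (p τ : Fin m → ℕ) : Fin n →₀ ℕ :=
  Finsupp.equivFunOnFinite.symm fun q => ∑ i : Fin m, if p i = q + 1 then N + τ i - p i else 0

theorem rowExponent_apply_of_eq {N : ℕ} {p τ : Fin m → ℕ} (hp : Function.Injective p) {q : Fin n}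
    {i : Fin m} (h : p i = q + 1) : rowExponent n N p τ q = N + τ i - p i := by
  rw [rowExponent, Finsupp.equivFunOnFinite_symm_apply_apply, Finset.sum_eq_single i]
  · rw [if_pos h]
  · intro j _ hj
    exact if_neg fun h' => hj (hp (h'.trans h.symm))
  · simp

theorem rowExponent_apply_of_ne {N : ℕ} {p τ : Fin m → ℕ} {q : Fin n}
    (h : ∀ i, p i ≠ q + 1) : rowExponent n N p τ q = 0 := by
  rw [rowExponent, Finsupp.equivFunOnFinite_symm_apply_apply]
  exact Finset.sum_eq_zero fun i _ => if_neg (h i)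

/-- At the last moved row i the exponent of the variable with index p_i - 1 drops from N+i-p_i to
N+σ(i)-p_i, and all larger variables keep theirs. The second alternative collects the σ for which a
subtraction would be truncated; there a matrix entry is zero. -/
theorem rowExponent_lt {N : ℕ} {p : Fin m → ℕ} (hp : StrictMono p) (h0 : ∀ i, 0 < p i)
    (hn : ∀ i, p i ≤ n) {σ : Equiv.Perm (Fin m)} (hσ : σ ≠ 1) :
    (neglex n).toSyn (rowExponent n N p fun i => σ i) <
      (neglex n).toSyn (rowExponent n N p fun i => i) ∨ ∃ i, N + (σ i : ℕ) < p i := by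
  by_cases hbad : ∃ i, N + (σ i : ℕ) < p i
  · exact Or.inr hbad
  push Not at hbad
  left
  obtain ⟨i, hi, habove⟩ := perm_exists_last_moved σ hσ
  have h0i := h0 i
  have hni := hn i
  have hq : p i = (⟨p i - 1, by omega⟩ : Fin n) + 1 := by simp only; omega
  rw [neglex_lt_iff]
  refine ⟨⟨p i - 1, by omega⟩, fun q hq' => ?_, ?_⟩
  · by_cases hex : ∃ j, p j = q + 1
    · obtain ⟨j, hj⟩ := hex
      have hij : i < j := by
        rw [← hp.lt_iff_lt]
        have : p i - 1 < q := hq'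
        omega
      rw [rowExponent_apply_of_eq hp.injective hj, rowExponent_apply_of_eq hp.injective hj,
        habove j hij]
    · push Not at hex
      rw [rowExponent_apply_of_ne hex, rowExponent_apply_of_ne hex]
  · rw [rowExponent_apply_of_eq hp.injective hq, rowExponent_apply_of_eq hp.injective hq]
    have h1 := hbad i
    have h2 : (σ i : ℕ) < i := hi
    omega

theorem prod_coeff_hSeries_monic {N : ℕ} {p τ : Fin m → ℕ} (h0 : ∀ i, 0 < p i)
    (hn : ∀ i, p i ≤ n) (hτ : ∀ i, p i ≤ N + τ i) :
    (neglex n).Monic (∏ i, PowerSeries.coeff (N + τ i)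
      (PowerSeries.X ^ p i * hSeries (varSeq F n) (p i))) ∧
    (neglex n).degree (∏ i, PowerSeries.coeff (N + τ i)
      (PowerSeries.X ^ p i * hSeries (varSeq F n) (p i))) = rowExponent n N p τ := by
  have hterm : ∀ i, (neglex n).Monic (PowerSeries.coeff (N + τ i)
      (PowerSeries.X ^ p i * hSeries (varSeq F n) (p i))) ∧
    (neglex n).degree (PowerSeries.coeff (N + τ i)
      (PowerSeries.X ^ p i * hSeries (varSeq F n) (p i))) =
        Finsupp.single (⟨p i - 1, by have := h0 i; have := hn i; omega⟩ : Fin n)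
          (N + τ i - p i) := by
    intro i
    have h0i := h0 i
    have hni := hn i
    rw [PowerSeries.coeff_X_pow_mul', if_pos (hτ i)]
    have := coeff_hSeries_monic (F := F) (n := n) (p i - 1) (by omega) (N + τ i - p i)
    rwa [Nat.sub_add_cancel (h0 i)] at this
  refine ⟨MonomialOrder.Monic.prod fun i _ => (hterm i).1, ?_⟩
  rw [MonomialOrder.degree_prod fun i _ => (hterm i).1.ne_zero]
  ext q
  rw [rowExponent, Finsupp.equivFunOnFinite_symm_apply_apply, Finsupp.finsetSum_apply]
  refine Finset.sum_congr rfl fun i _ => ?_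
  rw [(hterm i).2, Finsupp.single_apply]
  have := h0 i
  congr 1
  rw [Fin.ext_iff, eq_iff_iff]
  simp only
  omega

/-- In the Leibniz expansion each non-identity permutation contributes zero or a product of strictly
smaller degree. At the diagonal exponent and above it, the coefficients are thus those of the
diagonal product. -/
theorem det_flaggedMatrix_monic {N : ℕ} {p : Fin m → ℕ} (hp : StrictMono p) (h0 : ∀ i, 0 < p i)
    (hn : ∀ i, p i ≤ n) (hpN : ∀ i, p i ≤ N + i) :
    (neglex n).Monic (flaggedMatrix (varSeq F n) N p p).det ∧
      (neglex n).degree (flaggedMatrix (varSeq F n) N p p).det =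
        Finsupp.equivFunOnFinite.symm (flaggedComposition n N p p) := by
  -- Here `flaggedComposition n N p p` is definitionally the row exponent of the identity
  -- permutation.
  change _ ∧ _ = rowExponent n N p fun i => i
  have hterm : ∀ σ : Equiv.Perm (Fin m), σ ≠ 1 → ∀ c,
      (neglex n).toSyn (rowExponent n N p fun i => i) ≤ (neglex n).toSyn c →
        (∏ i, (flaggedMatrix (varSeq F n) N p p) i (σ i)).coeff c = 0 := by
    intro σ hσ c hc
    by_cases hbad : ∃ i, N + (σ i : ℕ) < p i
    · obtain ⟨i, hi⟩ := hbad
      rw [Finset.prod_eq_zero (Finset.mem_univ i), coeff_zero]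
      rw [flaggedMatrix_apply, PowerSeries.coeff_X_pow_mul', if_neg (not_le.mpr hi)]
    · have hlt := (rowExponent_lt hp h0 hn hσ).resolve_right hbad
      push Not at hbad
      apply MonomialOrder.coeff_eq_zero_of_lt (m := neglex n)
      have h := (prod_coeff_hSeries_monic (F := F) (τ := fun i => (σ i : ℕ)) h0 hn hbad).2
      simp only [flaggedMatrix_apply]
      rw [h]
      exact hlt.trans_le hc
  have hdiag := prod_coeff_hSeries_monic (F := F) (τ := fun i : Fin m => (i : ℕ)) h0 hn hpN
  have hcoeff : ∀ c, (neglex n).toSyn (rowExponent n N p fun i => i) ≤ (neglex n).toSyn c →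
      (flaggedMatrix (varSeq F n) N p p).det.coeff c =
        (∏ i, (flaggedMatrix (varSeq F n) N p p) i i).coeff c := by
    intro c hc
    rw [← Matrix.det_transpose, Matrix.det_apply, ← MvPolynomial.lcoeff_apply, map_sum,
      Finset.sum_eq_single 1]
    · simp [Matrix.transpose_apply]
    · intro σ _ hσ
      have := hterm σ hσ c hc
      simp only [Matrix.transpose_apply, Units.smul_def, map_zsmul, lcoeff_apply, this, smul_zero]
    · simp
  refine monic_and_degree_eq_of_coeff _ ?_ ?_
  · rw [hcoeff _ le_rfl]
    have := hdiag.1.coeff_degree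
    rw [hdiag.2] at this
    exact this
  · intro c hc
    rw [hcoeff c hc.le]
    apply MonomialOrder.coeff_eq_zero_of_lt (m := neglex n)
    simp only [flaggedMatrix_apply]
    rw [hdiag.2]
    exact hc

end Leading

/-! ### The Demazure characters of reversed skip compositions -/

section Skip

variable {n k : ℕ} {F : Type*} [Field F]

/-- With the elements of S listed as e_0 < e_1 < ⋯, the reversal sends place e_i to n+1-e_i, and p
lists these places in increasing order. Row n-k-i then carries (k+1)+(n-k-i)-(n+1-e_i) = e_i - i,
which is the skip entry s_j - j + 1 for j = i+1. The bound p_i < k+1+i is e_i ≥ i+1 in disguise. -/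
theorem exists_flaggedComposition_eq (hkn : k ≤ n) {S : Finset ℕ}
    (hS : S ⊆ Finset.Icc 1 (n - 1)) (hcard : S.card = n - k + 1) :
    ∃ p : Fin (n - k + 1) → ℕ, StrictMono p ∧ (∀ i, 0 < p i) ∧ (∀ i, p i ≤ n) ∧
      (∀ i, p i < k + 1 + i) ∧
        reverseSkipComposition n S = flaggedComposition n (k + 1) p p := by
  set e := S.orderEmbOfFin hcard with he
  have hmem : ∀ i, 1 ≤ e i ∧ e i ≤ n - 1 := fun i =>
    Finset.mem_Icc.mp (hS (S.orderEmbOfFin_mem hcard i))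
  have hlow : ∀ i : Fin (n - k + 1), (i : ℕ) + 1 ≤ e i := by
    rintro ⟨i, hi⟩
    induction i with
    | zero => exact (hmem _).1
    | succ i ih =>
      have h1 := ih (by omega)
      have h2 : e ⟨i, by omega⟩ < e ⟨i + 1, hi⟩ := e.strictMono (by simp [Fin.lt_def])
      simp only at h1 ⊢
      omega
  have hp : StrictMono fun i : Fin (n - k + 1) => n + 1 - e i.rev := by
    intro i j hij
    have h1 : e j.rev < e i.rev := e.strictMono (Fin.rev_lt_rev.mpr hij)
    have h2 := hmem i.rev
    simp only
    omega
  refine ⟨fun i => n + 1 - e i.rev, hp, ?_, ?_, ?_, ?_⟩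
  · intro i
    have := hmem i.rev
    simp only
    omega
  · intro i
    have := hmem i.rev
    simp only
    omega
  · intro i
    have h1 := hlow i.rev
    have h2 := hmem i.rev
    rw [Fin.val_rev] at h1
    simp only
    omega
  · funext q
    rw [reverseSkipComposition, skipComposition]
    have hq : (q.rev : ℕ) + 1 = n - q := by rw [Fin.val_rev]; omega
    have hq' := q.2
    rw [hq]
    split_ifs with hqS
    · obtain ⟨i, hi⟩ : ∃ i, e i = n - q := by
        have : n - (q : ℕ) ∈ Set.range e := by
          rw [he, Finset.range_orderEmbOfFin]; exact hqS
        exact this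
      rw [flaggedComposition_of_eq (i := i.rev) hp.injective
        (by rw [Fin.rev_rev, hi]; omega)]
      have hc : (S.filter (· ≤ n - (q : ℕ))).card = i + 1 := by
        have : S.filter (· ≤ n - (q : ℕ)) = (Finset.Iic i).map e.toEmbedding := by
          ext s
          simp only [Finset.mem_filter, Finset.mem_map, Finset.mem_Iic]
          constructor
          · rintro ⟨hs, hle⟩
            have : s ∈ Set.range e := by rw [he, Finset.range_orderEmbOfFin]; exact hs
            obtain ⟨j, rfl⟩ := this
            rw [← hi, e.le_iff_le] at hle
            exact ⟨j, hle, rfl⟩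
          · rintro ⟨j, hj, rfl⟩
            exact ⟨S.orderEmbOfFin_mem hcard j, hi ▸ e.monotone hj⟩
        rw [this, Finset.card_map, Fin.card_Iic]
      rw [hc, Fin.rev_rev, hi, Fin.val_rev]
      have := hlow i
      have := i.2
      omega
    · rw [flaggedComposition_of_ne]
      intro i hi
      have h1 := hmem i.rev
      apply hqS
      have : n - (q : ℕ) = e i.rev := by omega
      rw [this]
      exact S.orderEmbOfFin_mem hcard _

theorem esymm_mem_idealJ {d : ℕ} (h1 : n - k + 1 ≤ d) (h2 : d ≤ n) :
    esymm (Fin n) F d ∈ idealJ F n k :=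
  Ideal.subset_span (Or.inr ⟨d, h1, h2, rfl⟩)

theorem demazureCharacter_mem_idealJ (hkn : k ≤ n) {S : Finset ℕ}
    (hS : S ⊆ Finset.Icc 1 (n - 1)) (hcard : S.card = n - k + 1) :
    demazureCharacter F (reverseSkipComposition n S) ∈ idealJ F n k := by
  obtain ⟨p, hp, h0, hn, hpk, hrev⟩ := exists_flaggedComposition_eq hkn hS hcard
  rw [hrev, demazureCharacter_flaggedComposition (k + 1) p hp hpk p hp h0 hn]
  exact det_flaggedMatrix_mem (by omega) (by omega) _ (fun d => esymm_mem_idealJ) p hn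

theorem demazureCharacter_monic (hkn : k ≤ n) {S : Finset ℕ}
    (hS : S ⊆ Finset.Icc 1 (n - 1)) (hcard : S.card = n - k + 1) :
    (neglex n).Monic (demazureCharacter F (reverseSkipComposition n S)) ∧
      (neglex n).degree (demazureCharacter F (reverseSkipComposition n S)) =
        Finsupp.equivFunOnFinite.symm (reverseSkipComposition n S) := by
  obtain ⟨p, hp, h0, hn, hpk, hrev⟩ := exists_flaggedComposition_eq hkn hS hcard
  rw [hrev, demazureCharacter_flaggedComposition (k + 1) p hp hpk p hp h0 hn]
  exact det_flaggedMatrix_monic hp h0 hn fun i => (hpk i).le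

theorem completeHomogeneous_monic {i : ℕ} (hi : i ≤ n) (h1 : 1 ≤ i) :
    (neglex n).Monic (completeHomogeneous F n k i hi) ∧
      (neglex n).degree (completeHomogeneous F n k i hi) =
        Finsupp.single (⟨i - 1, by omega⟩ : Fin n) k := by
  rw [completeHomogeneous_eq_coeff]
  have := coeff_hSeries_monic (F := F) (n := n) (i - 1) (by omega) k
  rwa [Nat.sub_add_cancel h1] at this

end Skip

/-! ### Counting words by a status that moves up one step at a time -/

section Words

theorem card_filter_eq_sum_card_filter_snoc {m : ℕ} (A : Finset (Fin m → ℕ))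
    (B : Finset (Fin (m + 1) → ℕ)) (C : (Fin m → ℕ) → Finset ℕ)
    (hB : ∀ w, w ∈ B ↔ Fin.init w ∈ A ∧ w (Fin.last m) ∈ C (Fin.init w))
    (P : (Fin (m + 1) → ℕ) → Prop) [DecidablePred P] :
    (B.filter P).card = ∑ w ∈ A, ((C w).filter fun x => P (Fin.snoc w x)).card := by
  rw [Finset.card_eq_sum_card_fiberwise (f := fun w => Fin.init w) (t := A)]
  · refine Finset.sum_congr rfl fun w hw => ?_
    symm
    refine Finset.card_bij (fun x _ => (Fin.snoc w x : Fin (m + 1) → ℕ)) ?_ ?_ ?_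
    · intro x hx
      rw [Finset.mem_filter] at hx
      rw [Finset.mem_filter, Finset.mem_filter, hB, Fin.init_snoc, Fin.snoc_last]
      exact ⟨⟨⟨hw, hx.1⟩, hx.2⟩, rfl⟩
    · intro x _ y _ h
      have := congrFun h (Fin.last m)
      simpa using this
    · intro u hu
      rw [Finset.mem_filter, Finset.mem_filter, hB] at hu
      obtain ⟨⟨⟨_, h2⟩, h3⟩, rfl⟩ := hu
      have e : (Fin.snoc (Fin.init u) (u (Fin.last m)) : Fin (m + 1) → ℕ) = u :=
        Fin.snoc_init_self u
      refine ⟨u (Fin.last m), ?_, e⟩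
      rw [Finset.mem_filter, e]
      exact ⟨h2, h3⟩
  · intro w hw
    rw [Finset.mem_coe, Finset.mem_filter, hB] at hw
    exact hw.1.1

/-- A letter appended to a word keeps its status or raises it by one, and the number of letters
doing either depends on the status alone. The sum has at most the term u = v - 1; written this way,
it needs no separate case v = 0. -/
theorem card_filter_status {m : ℕ} {A : Finset (Fin m → ℕ)}
    {B : Finset (Fin (m + 1) → ℕ)} {C : (Fin m → ℕ) → Finset ℕ}
    (hB : ∀ w, w ∈ B ↔ Fin.init w ∈ A ∧ w (Fin.last m) ∈ C (Fin.init w))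
    {s : (Fin m → ℕ) → ℕ} {s' : (Fin (m + 1) → ℕ) → ℕ} {stay move : ℕ → ℕ}
    (hs : ∀ w ∈ A, ∀ v, ((C w).filter fun x => s' (Fin.snoc w x) = v).card =
      (if s w = v then stay v else 0) + if s w + 1 = v then move (s w) else 0) (v : ℕ) :
    (B.filter fun w => s' w = v).card = stay v * (A.filter fun w => s w = v).card +
      ∑ u ∈ Finset.range v, if u + 1 = v then move u * (A.filter fun w => s w = u).card else 0 := by
  rw [card_filter_eq_sum_card_filter_snoc A B C hB, Finset.sum_congr rfl fun w hw => hs w hw v,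
    Finset.sum_add_distrib]
  congr 1
  · rw [← Finset.sum_filter, Finset.sum_const, smul_eq_mul, mul_comm]
  · rw [← Finset.sum_filter]
    cases v with
    | zero => simp
    | succ v =>
      rw [Finset.sum_eq_single v]
      · rw [if_pos rfl]
        simp only [add_left_inj]
        rw [Finset.sum_congr rfl fun w hw => congrArg move (Finset.mem_filter.mp hw).2,
          Finset.sum_const, smul_eq_mul, mul_comm]
      · intro u _ hu
        exact if_neg (by omega)
      · simp

/-- The generating series of numbers `N m v` that obey a one step recursion. -/
theorem mk_mul_eSeries_of_recursion (N : ℕ → ℕ → ℕ) (stay move : ℕ → ℕ)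
    (h0 : ∀ v, N 0 v = if v = 0 then 1 else 0)
    (hN : ∀ m v, N (m + 1) v = stay v * N m v +
      ∑ u ∈ Finset.range v, if u + 1 = v then move u * N m u else 0) (v : ℕ) :
    PowerSeries.mk (fun m => (N m v : ℤ)) * eSeries (fun u => (stay u : ℤ)) (v + 1) =
      PowerSeries.C (∏ u ∈ Finset.range v, (move u : ℤ)) * PowerSeries.X ^ v := by
  -- With G_v the series of the numbers N m v, the recursion reads (1 - stay(v+1) T) G_{v+1} =
  -- move(v) T G_v.
  have hstep : ∀ v, PowerSeries.mk (fun m => (N m (v + 1) : ℤ)) * linearFactor (stay (v + 1) : ℤ) =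
      PowerSeries.C (move v : ℤ) * PowerSeries.X * PowerSeries.mk (fun m => (N m v : ℤ)) := by
    intro v
    ext d
    rw [linearFactor, mul_sub, mul_one, mul_left_comm, map_sub, PowerSeries.coeff_C_mul, mul_assoc,
      PowerSeries.coeff_C_mul]
    cases d with
    | zero => simp [h0]
    | succ d =>
      rw [PowerSeries.coeff_succ_mul_X, PowerSeries.coeff_succ_X_mul, PowerSeries.coeff_mk,
        PowerSeries.coeff_mk, PowerSeries.coeff_mk, hN, Finset.sum_eq_single v]
      · push_cast
        rw [if_pos rfl]
        ring
      · intro u _ hu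
        exact if_neg (by omega)
      · simp
  have hzero : PowerSeries.mk (fun m => (N m 0 : ℤ)) * linearFactor (stay 0 : ℤ) = 1 := by
    ext d
    rw [linearFactor, mul_sub, mul_one, mul_left_comm, map_sub, PowerSeries.coeff_C_mul]
    cases d with
    | zero => simp [h0]
    | succ d =>
      rw [PowerSeries.coeff_succ_mul_X, PowerSeries.coeff_mk, PowerSeries.coeff_mk, hN,
        PowerSeries.coeff_one, if_neg d.succ_ne_zero]
      simp
  induction v with
  | zero =>
    rw [eSeries_succ, eSeries, Finset.prod_range_zero, one_mul, hzero]
    simp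
  | succ v ih =>
    rw [eSeries_succ, mul_left_comm, hstep, Finset.prod_range_succ, map_mul, pow_succ]
    linear_combination (PowerSeries.C (move v : ℤ) * PowerSeries.X) * ih

end Words

/-! ### Standard exponents -/

section Standard

/-- The number of places before `i` that the greedy search for a skip pattern in `b` leaves out:
a place `j` is taken if `b j` exceeds the number of places left out before. -/
def greedySkipped (b : ℕ → ℕ) : ℕ → ℕ
  | 0 => 0
  | i + 1 => if greedySkipped b i < b i then greedySkipped b i else greedySkipped b i + 1

theorem greedySkipped_congr {b b' : ℕ → ℕ} {m : ℕ} (h : ∀ i < m, b i = b' i) :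
    greedySkipped b m = greedySkipped b' m := by
  induction m with
  | zero => rfl
  | succ m ih =>
    rw [greedySkipped, greedySkipped, ih fun i hi => h i (by omega), h m m.lt_succ_self]

/-- The set of places, counted from `1`, taken by the greedy search before `t`. -/
def greedyTaken (b : ℕ → ℕ) (t : ℕ) : Finset ℕ :=
  ((Finset.range t).filter fun i => greedySkipped b i < b i).map (addRightEmbedding 1)

theorem card_greedyTaken_add (b : ℕ → ℕ) (t : ℕ) :
    (greedyTaken b t).card + greedySkipped b t = t := by
  rw [greedyTaken, Finset.card_map]
  induction t with
  | zero => rfl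
  | succ t ih =>
    rw [Finset.range_add_one, Finset.filter_insert, greedySkipped]
    split_ifs with h
    · rw [Finset.card_insert_of_notMem (by simp)]
      omega
    · omega

theorem succ_mem_greedyTaken {b : ℕ → ℕ} {t i : ℕ} :
    i + 1 ∈ greedyTaken b t ↔ i < t ∧ greedySkipped b i < b i := by
  simp [greedyTaken]

theorem filter_greedyTaken (b : ℕ → ℕ) {t i : ℕ} (h : i ≤ t) :
    (greedyTaken b t).filter (· ≤ i) = greedyTaken b i := by
  ext s
  rw [Finset.mem_filter]
  cases s with
  | zero => simp [greedyTaken]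
  | succ s =>
    rw [succ_mem_greedyTaken, succ_mem_greedyTaken]
    constructor
    · rintro ⟨⟨_, h2⟩, h3⟩
      exact ⟨h3, h2⟩
    · rintro ⟨h1, h2⟩
      exact ⟨⟨by omega, h2⟩, h1⟩

/-- Stop the greedy search at the first moment when r places are taken. For a taken place the
required entry is one more than the number of places left out before it, which is exactly what the
greedy rule demands of b. That greedy is optimal is not needed, since only an upper bound on
standard monomials is used. -/
theorem exists_skip_pattern (b : ℕ → ℕ) {M r : ℕ} (h : r + greedySkipped b M ≤ M) :
    ∃ S ⊆ Finset.Icc 1 M, S.card = r ∧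
      ∀ i, i + 1 ∈ S → i + 1 - (S.filter (· ≤ i + 1)).card + 1 ≤ b i := by
  have hex : ∃ t, r ≤ (greedyTaken b t).card :=
    ⟨M, by have := card_greedyTaken_add b M; omega⟩
  classical
  obtain ⟨t, htM, ht⟩ : ∃ t ≤ M, (greedyTaken b t).card = r := by
    refine ⟨Nat.find hex, Nat.find_min' hex (by have := card_greedyTaken_add b M; omega), ?_⟩
    have h1 := Nat.find_spec hex
    rcases Nat.eq_zero_or_pos (Nat.find hex) with h0 | h0
    · have := card_greedyTaken_add b (Nat.find hex)
      omega
    · have h2 := Nat.find_min hex (Nat.sub_lt h0 one_pos)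
      obtain ⟨u, hu⟩ : ∃ u, Nat.find hex = u + 1 := ⟨Nat.find hex - 1, by omega⟩
      rw [hu, Nat.add_sub_cancel] at h2
      rw [hu] at h1 ⊢
      have h3 := card_greedyTaken_add b u
      have h4 := card_greedyTaken_add b (u + 1)
      have h5 : greedySkipped b u ≤ greedySkipped b (u + 1) := by
        rw [greedySkipped]; split_ifs <;> omega
      omega
  refine ⟨greedyTaken b t, ?_, ht, ?_⟩
  · intro s hs
    cases s with
    | zero => simp [greedyTaken] at hs
    | succ s =>
      rw [succ_mem_greedyTaken] at hs
      rw [Finset.mem_Icc]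
      omega
  · intro i hi
    rw [succ_mem_greedyTaken] at hi
    rw [filter_greedyTaken b (by omega : i + 1 ≤ t)]
    have h1 := card_greedyTaken_add b (i + 1)
    rw [greedySkipped, if_pos hi.2] at h1
    omega

/-- A word, continued by zeros. -/
def extendWord {m : ℕ} (w : Fin m → ℕ) (i : ℕ) : ℕ := if h : i < m then w ⟨i, h⟩ else 0

theorem extendWord_of_lt {m : ℕ} (w : Fin m → ℕ) {i : ℕ} (h : i < m) :
    extendWord w i = w ⟨i, h⟩ := dif_pos h

theorem extendWord_snoc_of_lt {m : ℕ} (w : Fin m → ℕ) (x : ℕ) {i : ℕ} (h : i < m) :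
    extendWord (Fin.snoc w x : Fin (m + 1) → ℕ) i = extendWord w i := by
  rw [extendWord_of_lt _ h, extendWord_of_lt _ (by omega)]
  exact Fin.snoc_castSucc (α := fun _ => ℕ) x w ⟨i, h⟩

theorem extendWord_snoc_self {m : ℕ} (w : Fin m → ℕ) (x : ℕ) :
    extendWord (Fin.snoc w x : Fin (m + 1) → ℕ) m = x := by
  rw [extendWord_of_lt _ m.lt_succ_self]
  exact Fin.snoc_last (α := fun _ => ℕ) x w

/-- The number of places the greedy search leaves out of a word, capped at `k - 1`. -/
def greedyStatus (k : ℕ) {m : ℕ} (w : Fin m → ℕ) : ℕ :=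
  min (greedySkipped (extendWord w) m) (k - 1)

/-- The words of length `m` in letters below `k` with a given greedy status. -/
def greedyCount (k m v : ℕ) : ℕ :=
  ((Fintype.piFinset fun _ : Fin m => Finset.range k).filter fun w => greedyStatus k w = v).card

theorem greedyCount_zero (k v : ℕ) : greedyCount k 0 v = if v = 0 then 1 else 0 := by
  have h : ∀ w : Fin 0 → ℕ, greedyStatus k w = 0 := fun w => by
    simp [greedyStatus, greedySkipped]
  rw [greedyCount]
  simp only [h]
  split_ifs with hv
  · subst hv; simp
  · simp [Ne.symm hv]

/-- At a status c < k-1, the k-1-c letters above c are taken and keep the status, while the c+1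
letters 0, …, c are left out and raise it. The cap k-1 is absorbing, so there all k letters stay. -/
theorem greedyCount_succ {k : ℕ} (hk : 1 ≤ k) (m v : ℕ) :
    greedyCount k (m + 1) v = (if v < k - 1 then k - 1 - v else k) * greedyCount k m v +
      ∑ u ∈ Finset.range v, if u + 1 = v then
        (if u < k - 1 then u + 1 else 0) * greedyCount k m u else 0 := by
  refine card_filter_status (C := fun _ => Finset.range k) (s := greedyStatus k)
    (stay := fun v => if v < k - 1 then k - 1 - v else k)
    (move := fun u => if u < k - 1 then u + 1 else 0) ?_ ?_ v
  · intro w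
    simp only [Fintype.mem_piFinset]
    constructor
    · intro h
      exact ⟨fun i => h i.castSucc, h (Fin.last m)⟩
    · rintro ⟨h1, h2⟩ i
      exact Fin.lastCases h2 h1 i
  · intro w _ v
    have hst : ∀ x, greedyStatus k (Fin.snoc w x : Fin (m + 1) → ℕ) =
        min (if greedySkipped (extendWord w) m < x then greedySkipped (extendWord w) m else
          greedySkipped (extendWord w) m + 1) (k - 1) := by
      intro x
      rw [greedyStatus, greedySkipped, extendWord_snoc_self,
        greedySkipped_congr fun i hi => extendWord_snoc_of_lt w x hi]
    simp only [hst]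
    rw [greedyStatus]
    generalize greedySkipped (extendWord w) m = c
    by_cases hc : c < k - 1
    · rw [min_eq_left hc.le]
      by_cases h1 : c = v
      · subst h1
        have e : (Finset.range k).filter
            (fun x => min (if c < x then c else c + 1) (k - 1) = c) = Finset.Ico (c + 1) k := by
          ext x
          simp only [Finset.mem_filter, Finset.mem_range, Finset.mem_Ico]
          split_ifs <;> omega
        rw [e, Nat.card_Ico]
        rw [if_pos rfl, if_pos hc, if_neg (by omega)]
        omega
      · by_cases h2 : c + 1 = v
        · subst h2
          have e : (Finset.range k).filter
              (fun x => min (if c < x then c else c + 1) (k - 1) = c + 1) =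
                Finset.range (c + 1) := by
            ext x
            simp only [Finset.mem_filter, Finset.mem_range]
            split_ifs <;> omega
          rw [e, Finset.card_range, if_neg h1, if_pos rfl, if_pos hc, zero_add]
        · rw [if_neg h1, if_neg h2, Finset.card_eq_zero, Finset.filter_eq_empty_iff]
          intro x _
          split_ifs <;> omega
    · have e : ∀ x, min (if c < x then c else c + 1) (k - 1) = k - 1 := by
        intro x
        split_ifs <;> omega
      rw [min_eq_right (by omega)]
      simp only [e, lt_irrefl, if_false, ite_self, add_zero]
      by_cases h1 : k - 1 = v
      · subst h1; simp
      · simp [h1]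

end Standard

/-! ### Injective words that cover an initial segment -/

section Covering

/-- The injective words `w` of length `m` with `w_i < k + i`. -/
def injectiveWords (k m : ℕ) : Finset (Fin m → ℕ) := by
  classical
  exact (Fintype.piFinset fun i : Fin m => Finset.range (k + i)).filter Function.Injective

theorem mem_injectiveWords {k m : ℕ} {w : Fin m → ℕ} :
    w ∈ injectiveWords k m ↔ (∀ i, w i < k + i) ∧ Function.Injective w := by
  simp [injectiveWords]

/-- The number of letters below `k` that occur in a word. -/
def coveredCount (k : ℕ) {m : ℕ} (w : Fin m → ℕ) : ℕ :=
  (Finset.range k ∩ Finset.univ.image w).card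

/-- The number of injective words `w` of length `m` with `w_i < k + i` in which `v` letters below
`k` occur. -/
def coveringCount (k m v : ℕ) : ℕ :=
  ((injectiveWords k m).filter fun w => coveredCount k w = v).card

theorem coveringCount_zero (k v : ℕ) : coveringCount k 0 v = if v = 0 then 1 else 0 := by
  have h : ∀ w : Fin 0 → ℕ, coveredCount k w = 0 := fun w => by simp [coveredCount]
  have h2 : injectiveWords k 0 = Finset.univ := by
    ext w
    simp only [mem_injectiveWords, Finset.mem_univ, iff_true]
    exact ⟨fun i => i.elim0, fun i => i.elim0⟩
  rw [coveringCount, h2]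
  simp only [h]
  split_ifs with hv
  · subst hv; simp
  · simp [Ne.symm hv]

/-- The m letters used so far all lie below k+m, so exactly k letters are free for the next place.
Of these, k-v lie below k and raise the covered count; the other v do not. -/
theorem coveringCount_succ (k m v : ℕ) :
    coveringCount k (m + 1) v = v * coveringCount k m v +
      ∑ u ∈ Finset.range v, if u + 1 = v then (k - u) * coveringCount k m u else 0 := by
  refine card_filter_status (C := fun w => Finset.range (k + m) \ Finset.univ.image w)
    (s := coveredCount k) (stay := fun v => v) (move := fun u => k - u) ?_ ?_ v
  · intro w
    simp only [mem_injectiveWords, Finset.mem_sdiff, Finset.mem_range, Finset.mem_image,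
      Finset.mem_univ, true_and, not_exists]
    constructor
    · rintro ⟨h1, h2⟩
      refine ⟨⟨fun i => h1 i.castSucc, fun i j h => ?_⟩, h1 (Fin.last m), fun i h => ?_⟩
      · exact Fin.castSucc_injective m (h2 h)
      · exact (Fin.castSucc_lt_last i).ne (h2 h)
    · rintro ⟨⟨h1, h2⟩, h3, h4⟩
      refine ⟨fun i => Fin.lastCases h3 h1 i, fun i j => ?_⟩
      refine Fin.lastCases ?_ (fun i => ?_) i <;> refine Fin.lastCases ?_ (fun j => ?_) j
      · intro _; rfl
      · intro h; exact absurd h.symm (h4 j)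
      · intro h; exact absurd h (h4 i)
      · intro h; exact congrArg Fin.castSucc (h2 h)
  · intro w hw v
    rw [mem_injectiveWords] at hw
    obtain ⟨hlt, hinj⟩ := hw
    set W := Finset.univ.image w with hW
    have hWcard : W.card = m := by
      rw [hW, Finset.card_image_of_injective _ hinj, Finset.card_univ, Fintype.card_fin]
    have hWsub : W ⊆ Finset.range (k + m) := by
      intro x hx
      rw [hW, Finset.mem_image] at hx
      obtain ⟨i, _, rfl⟩ := hx
      rw [Finset.mem_range]
      have := hlt i
      have := i.2
      omega
    have hst : ∀ x ∈ Finset.range (k + m) \ W, coveredCount k (Fin.snoc w x : Fin (m + 1) → ℕ) =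
        coveredCount k w + if x < k then 1 else 0 := by
      intro x hx
      have himg : Finset.univ.image (Fin.snoc w x : Fin (m + 1) → ℕ) = insert x W := by
        ext y
        simp only [hW, Finset.mem_image, Finset.mem_univ, true_and, Finset.mem_insert]
        rw [Fin.exists_fin_succ']
        simp [or_comm, eq_comm]
      rw [coveredCount, coveredCount, himg, ← hW]
      rw [Finset.mem_sdiff] at hx
      split_ifs with hxk
      · rw [Finset.inter_insert_of_mem (Finset.mem_range.mpr hxk),
          Finset.card_insert_of_notMem fun h => hx.2 (Finset.mem_inter.mp h).2]
      · rw [Finset.inter_insert_of_notMem (by simpa using hxk), add_zero]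
    have hle : coveredCount k w ≤ k :=
      (Finset.card_le_card Finset.inter_subset_left).trans (Finset.card_range k).le
    have hall : (Finset.range (k + m) \ W).card = k := by
      rw [Finset.card_sdiff_of_subset hWsub, hWcard, Finset.card_range]
      omega
    have hlow : ((Finset.range (k + m) \ W).filter (· < k)).card = k - coveredCount k w := by
      have : (Finset.range (k + m) \ W).filter (· < k) = Finset.range k \ W := by
        ext x
        simp only [Finset.mem_filter, Finset.mem_sdiff, Finset.mem_range]
        constructor
        · rintro ⟨⟨_, h⟩, h'⟩; exact ⟨h', h⟩
        · rintro ⟨h', h⟩; exact ⟨⟨by omega, h⟩, h'⟩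
      rw [this, Finset.card_sdiff, Finset.card_range, coveredCount, Finset.inter_comm]
    have hhigh : ((Finset.range (k + m) \ W).filter fun x => ¬ x < k).card = coveredCount k w := by
      have := Finset.card_filter_add_card_filter_not (s := Finset.range (k + m) \ W) (· < k)
      omega
    rw [Finset.filter_congr fun x hx => by rw [hst x hx]]
    by_cases h1 : coveredCount k w = v
    · have e : (Finset.range (k + m) \ W).filter
          (fun x => coveredCount k w + (if x < k then 1 else 0) = v) =
            (Finset.range (k + m) \ W).filter fun x => ¬ x < k := by
        refine Finset.filter_congr fun x _ => ?_
        split_ifs with h <;> simp [h, h1]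
      rw [e, hhigh, if_pos h1, if_neg (by omega), h1, add_zero]
    · by_cases h2 : coveredCount k w + 1 = v
      · have e : (Finset.range (k + m) \ W).filter
            (fun x => coveredCount k w + (if x < k then 1 else 0) = v) =
              (Finset.range (k + m) \ W).filter fun x => x < k := by
          refine Finset.filter_congr fun x _ => ?_
          split_ifs with h <;> simp [h, h2, h1]
        rw [e, hlow, if_neg h1, if_pos h2, zero_add]
      · rw [if_neg h1, if_neg h2, Finset.card_eq_zero, Finset.filter_eq_empty_iff]
        intro x _
        split_ifs <;> omega

end Covering

/-! ### Equality of the two counts -/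

/-- The two generating series are k! T^k and (k+1)! T^{k+1}, each divided by (1-T)(1-2T)⋯(1-(k+1)T).
Both sides are thus (k+1)! times the Stirling number S(n+1, k+1). -/
theorem mul_greedyCount_eq_coveringCount (n k : ℕ) :
    (k + 1) * greedyCount (k + 1) n k = coveringCount (k + 1) (n + 1) (k + 1) := by
  have h1 := mk_mul_eSeries_of_recursion _ _ _ (greedyCount_zero (k + 1))
    (greedyCount_succ k.succ_pos) k
  have h2 := mk_mul_eSeries_of_recursion _ (fun v => v) (fun u => k + 1 - u)
    (coveringCount_zero (k + 1)) (coveringCount_succ (k + 1)) (k + 1)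
  -- The stay weights are k, k-1, …, 1 followed by k+1, a rearrangement of 1, …, k+1.
  have e1 : eSeries (fun u => ((if u < k + 1 - 1 then k + 1 - 1 - u else k + 1 : ℕ) : ℤ)) (k + 1) =
      eSeries (fun u => ((u + 1 : ℕ) : ℤ)) (k + 1) := by
    rw [eSeries_succ, eSeries_succ, eSeries, eSeries,
      ← Finset.prod_range_reflect (fun q => linearFactor ((q + 1 : ℕ) : ℤ))]
    congr 1
    · refine Finset.prod_congr rfl fun u hu => ?_
      rw [Finset.mem_range] at hu
      rw [Nat.add_sub_cancel, if_pos hu, (by omega : k - u = k - 1 - u + 1)]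
    · simp
  -- The stay weight 0 contributes the factor 1.
  have e2 : eSeries (fun u => ((u : ℕ) : ℤ)) (k + 1 + 1) =
      eSeries (fun u => ((u + 1 : ℕ) : ℤ)) (k + 1) := by
    rw [eSeries, Finset.prod_range_succ']
    simp [eSeries, linearFactor]
  have e3 : ∏ u ∈ Finset.range (k + 1), ((k + 1 - u : ℕ) : ℤ) = ((k + 1).factorial : ℤ) := by
    rw [← Finset.prod_range_reflect, ← Nat.cast_prod, ← Finset.prod_range_add_one_eq_factorial]
    congr 1
    refine Finset.prod_congr rfl fun u hu => ?_
    rw [Finset.mem_range] at hu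
    omega
  have e4 : ∏ u ∈ Finset.range k, ((if u < k + 1 - 1 then u + 1 else 0 : ℕ) : ℤ) =
      (k.factorial : ℤ) := by
    rw [← Nat.cast_prod, ← Finset.prod_range_add_one_eq_factorial]
    congr 1
    refine Finset.prod_congr rfl fun u hu => ?_
    rw [Finset.mem_range] at hu
    exact if_pos hu
  rw [e1, e4] at h1
  rw [e2, e3, Nat.factorial_succ] at h2
  have hE := hSeries_mul_eSeries (fun u => ((u + 1 : ℕ) : ℤ)) (k + 1)
  set E := eSeries (fun u => ((u + 1 : ℕ) : ℤ)) (k + 1)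
  set H := hSeries (fun u => ((u + 1 : ℕ) : ℤ)) (k + 1)
  have h3 : PowerSeries.mk (fun m => (coveringCount (k + 1) m (k + 1) : ℤ)) =
      PowerSeries.C ((k + 1 : ℕ) : ℤ) *
        (PowerSeries.mk (fun m => (greedyCount (k + 1) m k : ℤ)) * PowerSeries.X) := by
    rw [Nat.cast_mul, map_mul] at h2
    linear_combination H * h2
      - PowerSeries.C ((k + 1 : ℕ) : ℤ) * PowerSeries.X * H * h1
      - (PowerSeries.mk (fun m => (coveringCount (k + 1) m (k + 1) : ℤ))
        - PowerSeries.C ((k + 1 : ℕ) : ℤ) *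
          (PowerSeries.mk (fun m => (greedyCount (k + 1) m k : ℤ)) * PowerSeries.X)) * hE
  have h4 := congrArg (PowerSeries.coeff (n + 1)) h3
  rw [PowerSeries.coeff_C_mul, PowerSeries.coeff_succ_mul_X, PowerSeries.coeff_mk,
    PowerSeries.coeff_mk] at h4
  exact_mod_cast h4.symm

/-! ### Polynomials of bounded degree and evaluation at finitely many points -/

section Degree

variable {σ K : Type*} [Field K]

/-- The polynomials of total degree less than `d`. -/
def degreeLT (σ K : Type*) [Field K] (d : ℕ) : Submodule K (MvPolynomial σ K) :=
  restrictSupport K {a | a.degree < d}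

theorem mem_degreeLT {d : ℕ} {p : MvPolynomial σ K} :
    p ∈ degreeLT σ K d ↔ ∀ a, d ≤ a.degree → p.coeff a = 0 := by
  rw [degreeLT, mem_restrictSupport_iff]
  constructor
  · intro h a ha
    by_contra hne
    exact absurd (h (mem_support_iff.mpr hne)) (not_lt.mpr ha)
  · intro h a ha
    by_contra hne
    exact mem_support_iff.mp ha (h a (not_lt.mp hne))

theorem IsHomogeneous.mem_degreeLT {d e : ℕ} {p : MvPolynomial σ K} (hp : p.IsHomogeneous e)
    (hed : e < d) : p ∈ degreeLT σ K d :=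
  ZeroHecke.mem_degreeLT.mpr fun _ ha => hp.coeff_eq_zero (by omega)

theorem sub_homogeneousComponent_mem_degreeLT {d : ℕ} {p : MvPolynomial σ K}
    (hp : p ∈ degreeLT σ K (d + 1)) : p - homogeneousComponent d p ∈ degreeLT σ K d := by
  rw [mem_degreeLT] at hp ⊢
  intro a ha
  rw [coeff_sub, coeff_homogeneousComponent]
  split_ifs with h
  · exact sub_self _
  · rw [sub_zero]
    exact hp a (by omega)

theorem mul_X_mem_degreeLT {d : ℕ} {p : MvPolynomial σ K} (hp : p ∈ degreeLT σ K d) (i : σ) :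
    p * X i ∈ degreeLT σ K (d + 1) := by
  classical
  rw [mem_degreeLT] at hp ⊢
  intro a ha
  rw [coeff_mul_X']
  split_ifs with h
  · apply hp
    have h1 : a - Finsupp.single i 1 + Finsupp.single i 1 = a :=
      tsub_add_cancel_of_le (Finsupp.single_le_iff.mpr
        (Nat.one_le_iff_ne_zero.mpr (Finsupp.mem_support_iff.mp h)))
    have h2 := congrArg Finsupp.degree h1
    rw [map_add, Finsupp.degree_single] at h2
    omega
  · rfl

theorem homogeneousComponent_succ_mul_X (d : ℕ) (p : MvPolynomial σ K) (i : σ) :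
    homogeneousComponent (d + 1) (p * X i) = homogeneousComponent d p * X i := by
  classical
  ext a
  rw [coeff_homogeneousComponent, coeff_mul_X', coeff_mul_X', coeff_homogeneousComponent]
  by_cases h : i ∈ a.support
  · have h1 : a - Finsupp.single i 1 + Finsupp.single i 1 = a :=
      tsub_add_cancel_of_le (Finsupp.single_le_iff.mpr
        (Nat.one_le_iff_ne_zero.mpr (Finsupp.mem_support_iff.mp h)))
    have h2 := congrArg Finsupp.degree h1
    rw [map_add, Finsupp.degree_single] at h2
    rw [if_pos h, if_pos h]
    congr 1
    rw [eq_iff_iff]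
    omega
  · rw [if_neg h, if_neg h, ite_self]

theorem homogeneousComponent_mem_restrictSupport {M : Set (σ →₀ ℕ)} {p : MvPolynomial σ K}
    (hp : p ∈ restrictSupport K M) (d : ℕ) :
    homogeneousComponent d p ∈ restrictSupport K M := by
  rw [mem_restrictSupport_iff] at hp ⊢
  intro a ha
  apply hp
  rw [Finset.mem_coe, mem_support_iff, coeff_homogeneousComponent] at ha
  rw [Finset.mem_coe, mem_support_iff]
  exact fun h => ha (by rw [h, ite_self])

/-- Every homogeneous component of `p` is the top component of an element of `I`. -/
def ComponentsLift (I : Ideal (MvPolynomial σ K)) (p : MvPolynomial σ K) : Prop :=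
  ∀ d, ∃ y ∈ I, homogeneousComponent d p - y ∈ degreeLT σ K d

theorem ComponentsLift.zero (I : Ideal (MvPolynomial σ K)) : ComponentsLift I 0 := fun d =>
  ⟨0, I.zero_mem, by simp⟩

/-- Since every component is lifted, and not only the top one, cancellation of top components in a
sum does no harm. This is what allows the condition to be checked on ideal generators. -/
theorem ComponentsLift.add {I : Ideal (MvPolynomial σ K)} {p q : MvPolynomial σ K}
    (hp : ComponentsLift I p) (hq : ComponentsLift I q) : ComponentsLift I (p + q) := fun d => by
  obtain ⟨y, hy, h1⟩ := hp d
  obtain ⟨z, hz, h2⟩ := hq d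
  refine ⟨y + z, I.add_mem hy hz, ?_⟩
  rw [map_add, add_sub_add_comm]
  exact Submodule.add_mem _ h1 h2

theorem ComponentsLift.mul {I : Ideal (MvPolynomial σ K)} {p : MvPolynomial σ K}
    (hp : ComponentsLift I p) (a : MvPolynomial σ K) : ComponentsLift I (a * p) := by
  induction a using MvPolynomial.induction_on with
  | C c =>
    intro d
    obtain ⟨y, hy, h⟩ := hp d
    refine ⟨C c * y, I.mul_mem_left _ hy, ?_⟩
    rw [homogeneousComponent_C_mul, ← mul_sub, ← smul_eq_C_mul]
    exact Submodule.smul_mem _ _ h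
  | add a b ha hb =>
    rw [add_mul]
    exact ha.add hb
  | mul_X a i ha =>
    rw [mul_right_comm]
    intro d
    cases d with
    | zero =>
      refine ⟨0, I.zero_mem, ?_⟩
      classical
      rw [homogeneousComponent_zero, coeff_mul_X']
      simp
    | succ d =>
      obtain ⟨y, hy, h⟩ := ha d
      refine ⟨y * X i, I.mul_mem_right _ hy, ?_⟩
      rw [homogeneousComponent_succ_mul_X, ← sub_mul]
      exact mul_X_mem_degreeLT h i

theorem ComponentsLift.of_isHomogeneous {I : Ideal (MvPolynomial σ K)} {g y : MvPolynomial σ K}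
    {e : ℕ} (hg : g.IsHomogeneous e) (hy : y ∈ I) (h : y - g ∈ degreeLT σ K e) :
    ComponentsLift I g := by
  intro d
  rw [homogeneousComponent_of_mem hg]
  split_ifs with hd
  · subst hd
    refine ⟨y, hy, ?_⟩
    rw [← neg_sub]
    exact Submodule.neg_mem _ h
  · exact ⟨0, I.zero_mem, by simp⟩

theorem componentsLift_of_mem_span {I : Ideal (MvPolynomial σ K)} {B : Set (MvPolynomial σ K)}
    (hB : ∀ g ∈ B, ComponentsLift I g) {p : MvPolynomial σ K} (hp : p ∈ Ideal.span B) :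
    ComponentsLift I p := by
  induction hp using Submodule.span_induction with
  | mem g hg => exact hB g hg
  | zero => exact .zero I
  | add p q _ _ hp hq => exact hp.add hq
  | smul a p _ hp => exact hp.mul a

/-- Evaluation at the points of a finite set. -/
def evalPoints (Y : Finset (σ → K)) : MvPolynomial σ K →ₐ[K] (Y → K) :=
  AlgHom.pi fun y => aeval y.1

theorem evalPoints_apply (Y : Finset (σ → K)) (p : MvPolynomial σ K) (y : Y) :
    evalPoints Y p y = eval y.1 p := by
  simp [evalPoints, aeval_eq_eval]

theorem exists_eval_eq_ite (Y : Finset (σ → K)) (y : σ → K) :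
    ∃ p : MvPolynomial σ K, eval y p = 1 ∧ ∀ z ∈ Y, z ≠ y → eval z p = 0 := by
  classical
  induction Y using Finset.induction_on with
  | empty => exact ⟨1, by simp, by simp⟩
  | insert z Y _ ih =>
    obtain ⟨p, h1, h2⟩ := ih
    by_cases hz : z = y
    · refine ⟨p, h1, fun u hu huy => ?_⟩
      rcases Finset.mem_insert.mp hu with rfl | hu
      · exact absurd hz huy
      · exact h2 u hu huy
    · obtain ⟨i, hi⟩ := Function.ne_iff.mp (Ne.symm hz)
      refine ⟨C (y i - z i)⁻¹ * (X i - C (z i)) * p, ?_, fun u hu huy => ?_⟩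
      · simp [h1, inv_mul_cancel₀ (sub_ne_zero.mpr hi)]
      · rcases Finset.mem_insert.mp hu with rfl | hu
        · simp
        · simp [h2 u hu huy]

theorem evalPoints_surjective (Y : Finset (σ → K)) : Function.Surjective (evalPoints Y) := by
  classical
  intro f
  choose p h1 h2 using exists_eval_eq_ite Y
  refine ⟨∑ y : Y, C (f y) * p y.1, ?_⟩
  funext z
  rw [evalPoints_apply, map_sum, Finset.sum_eq_single z]
  · simp [h1]
  · intro y _ hy
    rw [map_mul, h2 y.1 z.1 z.2 fun h => hy (Subtype.ext h.symm), mul_zero]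
  · simp

/-- If an ideal `J` lies, up to lower order terms, in the vanishing ideal of a set of points with
at least as many elements as a set of monomials that spans modulo `J`, then these monomials are
linearly independent modulo `J`. -/
theorem eq_zero_of_mem_of_mem_restrictSupport (Y : Finset (σ → K)) (M : Finset (σ →₀ ℕ))
    (hMY : M.card ≤ Y.card) (J : Ideal (MvPolynomial σ K))
    (hspan : ∀ p, ∃ r ∈ restrictSupport K (M : Set (σ →₀ ℕ)), p - r ∈ J)
    (hlift : ∀ p ∈ J, ComponentsLift (RingHom.ker (evalPoints Y)) p)
    {r : MvPolynomial σ K} (hrJ : r ∈ J) (hrM : r ∈ restrictSupport K (M : Set (σ →₀ ℕ))) :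
    r = 0 := by
  set V := restrictSupport K (M : Set (σ →₀ ℕ)) with hV
  set I := RingHom.ker (evalPoints Y) with hI
  -- Modulo I, every polynomial reduces to the span V of M without raising the degree. If p - s lies
  -- in J with s in V, some y in I agrees with the degree d component of p - s up to lower terms, so
  -- p - s_d - y has degree below d and the induction applies.
  have hred : ∀ d, ∀ p ∈ degreeLT σ K d, ∃ v ∈ V, v ∈ degreeLT σ K d ∧ p - v ∈ I := by
    intro d
    induction d with
    | zero =>
      intro p hp
      have : p = 0 := by
        ext a
        exact mem_degreeLT.mp hp a (Nat.zero_le _)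
      exact ⟨0, V.zero_mem, Submodule.zero_mem _, by simp [this]⟩
    | succ d ih =>
      intro p hp
      obtain ⟨s, hsV, hs⟩ := hspan p
      obtain ⟨y, hyI, hy⟩ := hlift _ hs d
      obtain ⟨v, hvV, hvd, hv⟩ := ih (p - homogeneousComponent d s - y) (by
        have h := Submodule.add_mem _ (sub_homogeneousComponent_mem_degreeLT hp) hy
        rw [map_sub] at h
        convert h using 1
        ring)
      refine ⟨homogeneousComponent d s + v,
        V.add_mem (homogeneousComponent_mem_restrictSupport hsV d) hvV,
        Submodule.add_mem _ ?_ ?_, ?_⟩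
      · exact IsHomogeneous.mem_degreeLT (homogeneousComponent_isHomogeneous d s) d.lt_succ_self
      · exact mem_degreeLT.mpr fun a ha => mem_degreeLT.mp hvd a (by omega)
      · convert I.add_mem hv hyI using 1
        ring
  set f : V →ₗ[K] (Y → K) := (evalPoints Y).toLinearMap.domRestrict V with hf
  have hfsurj : Function.Surjective f := by
    intro u
    obtain ⟨p, rfl⟩ := evalPoints_surjective Y u
    obtain ⟨v, hvV, _, hv⟩ := hred (p.totalDegree + 1) p (mem_degreeLT.mpr fun a ha => by
      by_contra h
      have := le_totalDegree (mem_support_iff.mpr h)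
      have e : (a.sum fun _ e => e) = a.degree := rfl
      omega)
    refine ⟨⟨v, hvV⟩, ?_⟩
    rw [hI, RingHom.mem_ker, map_sub, sub_eq_zero] at hv
    exact hv.symm
  have hfin : Module.finrank K V = M.card := by
    rw [Module.finrank_eq_card_basis (basisRestrictSupport K (M : Set (σ →₀ ℕ)))]
    exact Fintype.card_coe M
  have : FiniteDimensional K V :=
    Module.Finite.of_basis (basisRestrictSupport K (M : Set (σ →₀ ℕ)))
  -- Evaluation maps V, of dimension |M| ≤ |Y|, onto the functions on Y, so it is bijective.
  have hfinj : Function.Injective f := by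
    have h1 : Module.finrank K (Y → K) = Y.card := by
      rw [Module.finrank_fintype_fun_eq_card, Fintype.card_coe]
    have h2 := LinearMap.finrank_le_finrank_of_surjective hfsurj
    exact (LinearMap.injective_iff_surjective_of_finrank_eq_finrank (by omega)).mpr hfsurj
  have hzero : ∀ v ∈ V, v ∈ I → v = 0 := by
    intro v hvV hvI
    have : f ⟨v, hvV⟩ = f 0 :=
      (RingHom.mem_ker.mp hvI : evalPoints Y v = 0).trans (LinearMap.map_zero f).symm
    exact congrArg Subtype.val (hfinj this)
  ext a
  -- The component r_d with d = |a| is, modulo I, of degree below d, hence congruent to some v in V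
  -- of degree below d. Then r_d - v lies in V and in I, so it is zero, while v has no coefficient
  -- at a.
  obtain ⟨y, hyI, hy⟩ := hlift r hrJ a.degree
  obtain ⟨v, hvV, hvd, hv⟩ := hred _ _ hy
  have h := hzero (homogeneousComponent a.degree r - v)
    (V.sub_mem (homogeneousComponent_mem_restrictSupport hrM _) hvV) (by
      convert I.add_mem hv hyI using 1
      ring)
  have h2 := congrArg (coeff a) h
  rw [coeff_sub, coeff_homogeneousComponent, if_pos rfl, mem_degreeLT.mp hvd a le_rfl,
    sub_zero] at h2
  exact h2

end Degree

/-! ### The points -/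

section Points

section PointSet

variable {n k : ℕ} {K : Type*}

/-- The points with coordinates `α (w i)`, for the injective words `w` with `w_i < k + i` in which
all letters below `k` occur. -/
def pointSet (n k : ℕ) (α : ℕ ↪ K) : Finset (Fin n → K) :=
  ((injectiveWords k n).filter fun w => coveredCount k w = k).map
    ⟨fun w i => α (w i), fun _ _ h => funext fun i => α.injective (congrFun h i)⟩

theorem card_pointSet (α : ℕ ↪ K) : (pointSet n k α).card = coveringCount k n k :=
  Finset.card_map _

theorem mem_pointSet {α : ℕ ↪ K} {y : Fin n → K} (hy : y ∈ pointSet n k α) :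
    ∃ w : Fin n → ℕ, (∀ i, w i < k + i) ∧ Function.Injective w ∧
      Finset.range k ⊆ Finset.univ.image w ∧ ∀ i, y i = α (w i) := by
  rw [pointSet, Finset.mem_map] at hy
  obtain ⟨w, hw, rfl⟩ := hy
  rw [Finset.mem_filter, mem_injectiveWords] at hw
  refine ⟨w, hw.1.1, hw.1.2, ?_, fun i => rfl⟩
  have h : Finset.range k ∩ Finset.univ.image w = Finset.range k :=
    Finset.eq_of_subset_of_card_le Finset.inter_subset_left (by
      rw [Finset.card_range]
      exact hw.2.ge)
  exact Finset.inter_eq_left.mp h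

end PointSet

variable {n k : ℕ} {K : Type*} [Field K]

/-- A power series over the polynomial ring whose coefficient of degree `d` is homogeneous of
degree `d`. -/
def IsGradedSeries (G : PowerSeries (MvPolynomial (Fin n) K)) : Prop :=
  ∀ d, (PowerSeries.coeff d G).IsHomogeneous d

theorem IsGradedSeries.mul {G H : PowerSeries (MvPolynomial (Fin n) K)} (hG : IsGradedSeries G)
    (hH : IsGradedSeries H) : IsGradedSeries (G * H) := by
  intro d
  rw [PowerSeries.coeff_mul]
  refine IsHomogeneous.sum _ _ _ fun u hu => ?_
  rw [← Finset.HasAntidiagonal.mem_antidiagonal.mp hu]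
  exact (hG _).mul (hH _)

theorem isGradedSeries_one : IsGradedSeries (1 : PowerSeries (MvPolynomial (Fin n) K)) := by
  intro d
  rw [PowerSeries.coeff_one]
  split_ifs with h
  · subst h
    exact isHomogeneous_one _ _
  · exact isHomogeneous_zero _ _ _

theorem isGradedSeries_prod {ι : Type*} (s : Finset ι)
    (G : ι → PowerSeries (MvPolynomial (Fin n) K)) (hG : ∀ i ∈ s, IsGradedSeries (G i)) :
    IsGradedSeries (∏ i ∈ s, G i) :=
  Finset.prod_induction _ IsGradedSeries (fun _ _ => IsGradedSeries.mul) isGradedSeries_one hG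

theorem varSeq_isHomogeneous (q : ℕ) : (varSeq K n q).IsHomogeneous 1 := by
  rw [varSeq]
  split_ifs
  · exact isHomogeneous_X _ _
  · exact isHomogeneous_zero _ _ _

theorem isGradedSeries_hSeries (p : ℕ) : IsGradedSeries (hSeries (varSeq K n) p) :=
  isGradedSeries_prod _ _ fun q _ d => by
    rw [geometricSeries, PowerSeries.coeff_mk]
    simpa using (varSeq_isHomogeneous q).pow d

theorem isGradedSeries_eSeries (p : ℕ) : IsGradedSeries (eSeries (varSeq K n) p) :=
  isGradedSeries_prod _ _ fun q _ d => by
    rw [linearFactor, map_sub]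
    refine (isGradedSeries_one d).sub ?_
    rw [PowerSeries.coeff_C_mul, PowerSeries.coeff_X]
    split_ifs with h
    · subst h
      rw [mul_one]
      exact varSeq_isHomogeneous q
    · rw [mul_zero]
      exact isHomogeneous_zero _ _ _

/-- Multiplication by a scalar power series with constant term `1` changes the coefficients of a
graded series by lower order terms. -/
theorem IsGradedSeries.coeff_mul_map_sub_mem_degreeLT
    {G : PowerSeries (MvPolynomial (Fin n) K)} (hG : IsGradedSeries G) (f : PowerSeries K)
    (hf : PowerSeries.coeff 0 f = 1) (d : ℕ) :
    PowerSeries.coeff d (G * PowerSeries.map C f) - PowerSeries.coeff d G ∈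
      degreeLT (Fin n) K d := by
  rw [PowerSeries.coeff_mul, Finset.Nat.sum_antidiagonal_eq_sum_range_succ
    (fun u v => PowerSeries.coeff u G * PowerSeries.coeff v (PowerSeries.map C f)),
    Finset.sum_range_succ, Nat.sub_self, PowerSeries.coeff_map, hf, map_one, mul_one,
    add_sub_cancel_right]
  refine Submodule.sum_mem _ fun u hu => ?_
  rw [PowerSeries.coeff_map, mul_comm, ← smul_eq_C_mul]
  exact Submodule.smul_mem _ _ (IsHomogeneous.mem_degreeLT (hG u) (Finset.mem_range.mp hu))

/-- The geometric factors over W cancel against linear ones, leaving a polynomial of degree at most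
|T| - |W| < d. -/
theorem coeff_prod_linearFactor_mul_prod_geometricSeries (f : ℕ → K) {W T : Finset ℕ}
    (hWT : W ⊆ T) {d : ℕ} (hd : T.card < W.card + d) :
    PowerSeries.coeff d ((∏ t ∈ T, linearFactor (f t)) * ∏ t ∈ W, geometricSeries (f t)) = 0 := by
  rw [← Finset.prod_sdiff hWT, mul_assoc, ← Finset.prod_mul_distrib,
    Finset.prod_congr rfl fun t _ => (mul_comm _ _).trans (geometricSeries_mul_linearFactor (f t)),
    Finset.prod_const_one, mul_one]
  refine coeff_prod_linearFactor_eq_zero _ _ ?_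
  rw [Finset.card_sdiff_of_subset hWT]
  have := Finset.card_le_card hWT
  omega

theorem map_eval_map_C (y : Fin n → K) (f : PowerSeries K) :
    PowerSeries.map (eval y) (PowerSeries.map C f) = f := by
  ext d
  simp

theorem eval_varSeq (y : Fin n → K) (q : Fin n) : eval y (varSeq K n q) = y q := by
  rw [varSeq_val, eval_X]

/-- The first i coordinates of a point are distinct members of α_0, …, α_{k+i-2}. Multiplying H_i by
the k+i-1 linear factors of these values therefore gives, at each point, a polynomial of degree k-1.
Its coefficient at T^k vanishes on the point set, and that coefficient equals h_k plus lower terms.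
-/
theorem componentsLift_completeHomogeneous (hk : 1 ≤ k) (α : ℕ ↪ K) {i : ℕ} (hi : i ≤ n)
    (h1 : 1 ≤ i) :
    ComponentsLift (RingHom.ker (evalPoints (pointSet n k α)))
      (completeHomogeneous K n k i hi) := by
  rw [completeHomogeneous_eq_coeff]
  set f : PowerSeries K := ∏ t ∈ Finset.range (k + i - 1), linearFactor (α t) with hf
  refine ComponentsLift.of_isHomogeneous (isGradedSeries_hSeries i k)
    (y := PowerSeries.coeff k (hSeries (varSeq K n) i * PowerSeries.map C f)) ?_
    ((isGradedSeries_hSeries i).coeff_mul_map_sub_mem_degreeLT f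
      (coeff_zero_prod_linearFactor _ _) k)
  rw [RingHom.mem_ker]
  funext ⟨y, hy⟩
  obtain ⟨w, hlt, hinj, -, hyw⟩ := mem_pointSet hy
  rw [evalPoints_apply, ← PowerSeries.coeff_map, map_mul, map_eval_map_C, map_hSeries, Pi.zero_apply]
  set W : Finset ℕ := Finset.univ.image fun q : Fin i => w (Fin.castLE hi q) with hW
  have hinj' : Function.Injective fun q : Fin i => w (Fin.castLE hi q) :=
    hinj.comp (Fin.castLE_injective hi)
  have hH : hSeries (fun q => eval y (varSeq K n q)) i = ∏ t ∈ W, geometricSeries (α t) := by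
    rw [hW, Finset.prod_image fun a _ b _ h => hinj' h, hSeries,
      ← Fin.prod_univ_eq_prod_range (fun q => geometricSeries (eval y (varSeq K n q)))]
    refine Finset.prod_congr rfl fun q _ => ?_
    rw [← hyw]
    exact congrArg geometricSeries (eval_varSeq y (Fin.castLE hi q))
  rw [hH, mul_comm]
  refine coeff_prod_linearFactor_mul_prod_geometricSeries α ?_ ?_
  · intro t ht
    rw [hW, Finset.mem_image] at ht
    obtain ⟨q, _, rfl⟩ := ht
    have h2 := hlt (Fin.castLE hi q)
    have h3 := q.2
    rw [Fin.val_castLE] at h2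
    rw [Finset.mem_range]
    omega
  · rw [Finset.card_range, hW, Finset.card_image_of_injective _ hinj', Finset.card_univ,
      Fintype.card_fin]
    omega

/-- Dually, each of α_0, …, α_{k-1} occurs among the n distinct coordinates, so dividing E_n by
their linear factors leaves a polynomial of degree n-k at each point. -/
theorem componentsLift_esymm (hkn : k ≤ n) (α : ℕ ↪ K) {d : ℕ} (hd : n - k + 1 ≤ d) :
    ComponentsLift (RingHom.ker (evalPoints (pointSet n k α))) (esymm (Fin n) K d) := by
  have he : esymm (Fin n) K d = (-1) ^ d * PowerSeries.coeff d (eSeries (varSeq K n) n) := by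
    rw [coeff_eSeries_varSeq, ← mul_assoc, ← mul_pow]
    simp
  rw [he]
  refine ComponentsLift.mul ?_ _
  set f : PowerSeries K := ∏ t ∈ Finset.range k, geometricSeries (α t) with hf
  refine ComponentsLift.of_isHomogeneous (isGradedSeries_eSeries n d)
    (y := PowerSeries.coeff d (eSeries (varSeq K n) n * PowerSeries.map C f)) ?_
    ((isGradedSeries_eSeries n).coeff_mul_map_sub_mem_degreeLT f
      (coeff_zero_hSeries (fun t => α t) k) d)
  rw [RingHom.mem_ker]
  funext ⟨y, hy⟩
  obtain ⟨w, -, hinj, hcov, hyw⟩ := mem_pointSet hy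
  rw [evalPoints_apply, ← PowerSeries.coeff_map, map_mul, map_eval_map_C, map_eSeries, Pi.zero_apply]
  have hE : eSeries (fun q => eval y (varSeq K n q)) n =
      ∏ t ∈ Finset.univ.image w, linearFactor (α t) := by
    rw [Finset.prod_image fun a _ b _ h => hinj h, eSeries,
      ← Fin.prod_univ_eq_prod_range (fun q => linearFactor (eval y (varSeq K n q)))]
    refine Finset.prod_congr rfl fun q _ => ?_
    rw [← hyw, eval_varSeq]
  rw [hE]
  refine coeff_prod_linearFactor_mul_prod_geometricSeries α hcov ?_
  rw [Finset.card_range, Finset.card_image_of_injective _ hinj, Finset.card_univ,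
    Fintype.card_fin]
  omega

theorem componentsLift_of_mem_idealJ (hk : 1 ≤ k) (hkn : k ≤ n) (α : ℕ ↪ K)
    {p : MvPolynomial (Fin n) K} (hp : p ∈ idealJ K n k) :
    ComponentsLift (RingHom.ker (evalPoints (pointSet n k α))) p := by
  refine componentsLift_of_mem_span ?_ hp
  rintro g (⟨i, hi, h1, rfl⟩ | ⟨d, hd, -, rfl⟩)
  · exact componentsLift_completeHomogeneous hk α hi h1
  · exact componentsLift_esymm hkn α hd

end Points

/-! ### The standard monomials -/

section StandardExponents

variable {n k : ℕ}

/-- The exponents that are divisible neither by some `x_i ^ k` nor by the leading monomial of a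
Demazure character in the candidate basis. -/
def standardExponents (n k : ℕ) : Finset (Fin n →₀ ℕ) := by
  classical
  exact ((Fintype.piFinset fun _ : Fin n => Finset.range k).map
    Finsupp.equivFunOnFinite.symm.toEmbedding).filter fun a =>
      ∀ S ⊆ Finset.Icc 1 (n - 1), S.card = n - k + 1 →
        ¬ Finsupp.equivFunOnFinite.symm (reverseSkipComposition n S) ≤ a

theorem mem_standardExponents {a : Fin n →₀ ℕ} :
    a ∈ standardExponents n k ↔ (∀ i, a i < k) ∧
      ∀ S ⊆ Finset.Icc 1 (n - 1), S.card = n - k + 1 →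
        ¬ Finsupp.equivFunOnFinite.symm (reverseSkipComposition n S) ≤ a := by
  refine (@Finset.mem_filter _ _ (_) _ _).trans ?_
  rw [Finset.mem_map_equiv, Fintype.mem_piFinset]
  simp

/-- The exponents are read from the last variable down, without that of the first variable, since S
never contains the last place. If fewer than k-1 of the n places were left out, at least n-k+2 would
be taken, giving a skip pattern whose monomial divides the standard one. -/
theorem greedyStatus_of_mem_standardExponents (hkn : k ≤ n + 1)
    {a : Fin (n + 1) →₀ ℕ} (ha : a ∈ standardExponents (n + 1) k) :
    greedyStatus k (fun i : Fin n => a i.castSucc.rev) = k - 1 := by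
  rw [mem_standardExponents] at ha
  set w : Fin n → ℕ := fun i => a i.castSucc.rev with hw
  rw [greedyStatus, min_eq_right]
  by_contra hlt
  obtain ⟨S, hS, hcard, hle⟩ := exists_skip_pattern (extendWord w) (M := n)
    (r := n + 1 - k + 1) (by omega)
  refine ha.2 S hS hcard fun q => ?_
  rw [Finsupp.equivFunOnFinite_symm_apply_apply, reverseSkipComposition, skipComposition]
  split_ifs with hq
  · have h1 := (Finset.mem_Icc.mp (hS hq)).2
    have h2 := hle _ hq
    rw [extendWord_of_lt w (by omega : (q.rev : ℕ) < n)] at h2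
    have h3 : w ⟨q.rev, by omega⟩ = a q := congrArg a (Fin.rev_rev q)
    rwa [h3] at h2
  · exact Nat.zero_le _

/-- The exponent of the first variable has at most k values, and the others form a word of length
n-1 of full greedy status. -/
theorem card_standardExponents_le (hk : 1 ≤ k) (hkn : k ≤ n) :
    (standardExponents n k).card ≤ coveringCount k n k := by
  obtain ⟨k, rfl⟩ := Nat.exists_eq_add_of_le' hk
  obtain ⟨n, rfl⟩ := Nat.exists_eq_add_of_le' (hk.trans hkn)
  rw [← mul_greedyCount_eq_coveringCount, greedyCount, mul_comm]
  refine le_of_le_of_eq (Finset.card_le_card_of_injOn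
    (t := ((Fintype.piFinset fun _ : Fin n => Finset.range (k + 1)).filter
      fun w => greedyStatus (k + 1) w = k) ×ˢ Finset.range (k + 1))
    (fun a => ((fun i : Fin n => a i.castSucc.rev), a (Fin.last n).rev)) ?_ ?_)
    (by rw [Finset.card_product, Finset.card_range])
  · intro a ha
    have h1 := greedyStatus_of_mem_standardExponents hkn ha
    have h2 := (mem_standardExponents.mp ha).1
    simp only [Finset.mem_coe, Finset.mem_product, Finset.mem_filter, Fintype.mem_piFinset,
      Finset.mem_range]
    exact ⟨⟨fun i => h2 _, h1⟩, h2 _⟩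
  · intro a _ b _ h
    rw [Prod.mk.injEq] at h
    ext i
    rw [← Fin.rev_rev i]
    exact Fin.lastCases (motive := fun j => a j.rev = b j.rev) h.2 (fun j => congrFun h.1 j) i.rev

end StandardExponents

/-! ### The Gröbner basis -/

section Basis

variable {F : Type*} [Field F] {n k : ℕ}

theorem groebnerSet_subset_idealJ (hkn : k ≤ n) {g : MvPolynomial (Fin n) F}
    (hg : g ∈ groebnerSet F n k) : g ∈ idealJ F n k := by
  rcases hg with ⟨i, hi, h1, rfl⟩ | ⟨S, hS, hcard, rfl⟩
  · exact Ideal.subset_span (Or.inl ⟨i, hi, h1, rfl⟩)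
  · exact demazureCharacter_mem_idealJ hkn hS hcard

theorem monic_of_mem_groebnerSet (hkn : k ≤ n) {g : MvPolynomial (Fin n) F}
    (hg : g ∈ groebnerSet F n k) : (neglex n).Monic g := by
  rcases hg with ⟨i, hi, h1, rfl⟩ | ⟨S, hS, hcard, rfl⟩
  · exact (completeHomogeneous_monic hi h1).1
  · exact (demazureCharacter_monic hkn hS hcard).1

theorem groebnerSet_finite : (groebnerSet F n k).Finite := by
  refine Set.Finite.union ?_ ?_
  · refine (Set.finite_range fun i : Fin (n + 1) =>
      completeHomogeneous F n k i (Nat.lt_succ_iff.mp i.2)).subset ?_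
    rintro f ⟨i, hi, -, rfl⟩
    exact ⟨⟨i, Nat.lt_succ_of_le hi⟩, rfl⟩
  · refine ((Finset.Icc 1 (n - 1)).powerset.finite_toSet.image fun S =>
      demazureCharacter F (reverseSkipComposition n S)).subset ?_
    rintro f ⟨S, hS, -, rfl⟩
    exact ⟨S, Finset.mem_coe.mpr (Finset.mem_powerset.mpr hS), rfl⟩

theorem mem_standardExponents_of_not_degree_le (hkn : k ≤ n) {a : Fin n →₀ ℕ}
    (ha : ∀ g ∈ groebnerSet F n k, ¬ (neglex n).degree g ≤ a) : a ∈ standardExponents n k := by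
  rw [mem_standardExponents]
  refine ⟨fun i => ?_, fun S hS hcard => ?_⟩
  · by_contra h
    refine ha _ (Or.inl ⟨i + 1, i.2, Nat.le_add_left _ _, rfl⟩) ?_
    rw [(completeHomogeneous_monic _ (Nat.le_add_left _ _)).2]
    exact Finsupp.single_le_iff.mpr (not_lt.mp h)
  · have h := ha _ (Or.inr ⟨S, hS, hcard, rfl⟩)
    rwa [(demazureCharacter_monic hkn hS hcard).2] at h

/-- Division by the candidate basis. -/
theorem exists_division (hkn : k ≤ n) (f : MvPolynomial (Fin n) F) :
    ∃ (q : groebnerSet F n k →₀ MvPolynomial (Fin n) F) (r : MvPolynomial (Fin n) F),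
      f = Finsupp.linearCombination _ (fun g : groebnerSet F n k => (g : MvPolynomial (Fin n) F)) q
        + r ∧
      (∀ g : groebnerSet F n k, (neglex n).toSyn ((neglex n).degree (g.1 * q g)) ≤
        (neglex n).toSyn ((neglex n).degree f)) ∧
      r ∈ restrictSupport F (standardExponents n k : Set (Fin n →₀ ℕ)) ∧
      f - r ∈ idealJ F n k := by
  obtain ⟨q, r, h1, h2, h3⟩ := (neglex n).div_set (B := groebnerSet F n k)
    (fun g hg => by rw [(monic_of_mem_groebnerSet hkn hg).leadingCoeff_eq_one]; exact isUnit_one) f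
  refine ⟨q, r, h1, h2, fun c hc => mem_standardExponents_of_not_degree_le hkn (h3 c hc), ?_⟩
  rw [h1, add_sub_cancel_right, Finsupp.linearCombination_apply]
  exact Ideal.sum_mem _ fun g _ => Ideal.mul_mem_left _ _ (groebnerSet_subset_idealJ hkn g.2)

theorem map_mem_idealJ {K : Type*} [Field K] (φ : F →+* K) {p : MvPolynomial (Fin n) F}
    (hp : p ∈ idealJ F n k) : map φ p ∈ idealJ K n k := by
  have h : (idealJ F n k).map (map φ) ≤ idealJ K n k := by
    rw [idealJ, Ideal.map_span, Ideal.span_le]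
    rintro _ ⟨g, ⟨i, hi, h1, rfl⟩ | ⟨d, h1, h2, rfl⟩, rfl⟩
    · refine Ideal.subset_span (Or.inl ⟨i, hi, h1, ?_⟩)
      rw [completeHomogeneous, completeHomogeneous, map_rename, map_hsymm]
    · refine Ideal.subset_span (Or.inr ⟨d, h1, h2, ?_⟩)
      rw [map_esymm]
  exact h (Ideal.mem_map_of_mem _ hp)

theorem eq_zero_of_mem_idealJ (hk : 1 ≤ k) (hkn : k ≤ n) {r : MvPolynomial (Fin n) F}
    (hr : r ∈ idealJ F n k)
    (hstd : r ∈ restrictSupport F (standardExponents n k : Set (Fin n →₀ ℕ))) : r = 0 := by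
  -- A finite field has too few distinct values α_t. The ideal and the standard exponents are
  -- compatible with extension of scalars, so the claim descends along the injection of
  -- coefficients.
  set K := AlgebraicClosure F
  set α : ℕ ↪ K := Infinite.natEmbedding K
  set φ : F →+* K := algebraMap F K
  refine map_injective φ φ.injective ?_
  rw [map_zero]
  refine eq_zero_of_mem_of_mem_restrictSupport (pointSet n k α) (standardExponents n k) ?_
    (idealJ K n k) ?_ (fun p hp => componentsLift_of_mem_idealJ hk hkn α hp) (map_mem_idealJ φ hr) ?_
  · rw [card_pointSet]
    exact card_standardExponents_le hk hkn
  · intro p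
    obtain ⟨-, r, -, -, h1, h2⟩ := exists_division hkn p
    exact ⟨r, h1, h2⟩
  · exact fun c hc => hstd (support_map_subset φ r hc)

theorem isGroebnerBasis_groebnerSet (hk : 1 ≤ k) (hkn : k ≤ n) :
    IsGroebnerBasis (neglex n) (groebnerSet F n k) (idealJ F n k) where
  finite := groebnerSet_finite
  mem := fun _ => groebnerSet_subset_idealJ hkn
  ne_zero := fun _ hg => (monic_of_mem_groebnerSet hkn hg).ne_zero
  initialIdeal_eq := by
    apply le_antisymm
    · rw [initialIdeal, Ideal.span_le]
      rintro _ ⟨f, ⟨hf, hf0⟩, rfl⟩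
      -- The remainder of f is standard and lies in the ideal, hence is zero. So f is a combination
      -- of the g whose summands do not exceed its degree, and one summand must attain it.
      have hnot : ¬ ∀ g ∈ groebnerSet F n k, ¬ (neglex n).degree g ≤ (neglex n).degree f := by
        intro hall
        obtain ⟨q, r, h1, h2, h3, h4⟩ := exists_division hkn f
        have hr : r ∈ idealJ F n k := by
          have := Ideal.sub_mem _ hf h4
          rwa [sub_sub_cancel] at this
        rw [eq_zero_of_mem_idealJ hk hkn hr h3, add_zero, Finsupp.linearCombination_apply,
          Finsupp.sum] at h1
        have hc : f.coeff ((neglex n).degree f) ≠ 0 :=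
          (neglex n).coeff_degree_ne_zero_iff.mpr hf0
        have hmem : (neglex n).degree f ∈ f.support := mem_support_iff.mpr hc
        rw [h1, coeff_sum] at hc
        obtain ⟨g, _, hg⟩ := Finset.exists_ne_zero_of_sum_ne_zero hc
        rw [← h1, smul_eq_mul, mul_comm] at hg
        have hq0 : q g ≠ 0 := by
          rintro h
          rw [h, mul_zero, coeff_zero] at hg
          exact hg rfl
        have hgm := monic_of_mem_groebnerSet hkn g.2
        have hle : (neglex n).degree (g.1 * q g) = (neglex n).degree f := by
          apply (neglex n).toSyn.injective
          exact le_antisymm (h2 g) ((neglex n).le_degree (mem_support_iff.mpr hg))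
        refine hall g.1 g.2 ?_
        rw [← hle, MonomialOrder.degree_mul hgm.ne_zero hq0]
        exact le_self_add
      push Not at hnot
      obtain ⟨g, hg, hle⟩ := hnot
      have hlt : (neglex n).leadingTerm g ∈
          Ideal.span ((neglex n).leadingTerm '' groebnerSet F n k) :=
        Ideal.subset_span ⟨g, hg, rfl⟩
      have hmul := Ideal.mul_mem_left _
        (monomial ((neglex n).degree f - (neglex n).degree g) ((neglex n).leadingCoeff f)) hlt
      rw [MonomialOrder.leadingTerm, monomial_mul, tsub_add_cancel_of_le hle,
        (monic_of_mem_groebnerSet hkn hg).leadingCoeff_eq_one, mul_one] at hmul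
      exact hmul
    · rw [Ideal.span_le]
      rintro _ ⟨g, hg, rfl⟩
      exact Ideal.subset_span ⟨g, ⟨groebnerSet_subset_idealJ hkn hg,
        (monic_of_mem_groebnerSet hkn hg).ne_zero⟩, rfl⟩

/-! ### Minimality -/

theorem skipComposition_pos_iff {S : Finset ℕ} (a : Fin n) :
    0 < skipComposition n S a ↔ (a : ℕ) + 1 ∈ S := by
  rw [skipComposition]
  split_ifs with h <;> simp [h]

theorem mem_iff_reverseSkipComposition_pos {S : Finset ℕ} (hS : S ⊆ Finset.Icc 1 (n - 1)) (s : ℕ) :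
    s ∈ S ↔ ∃ q : Fin n, (q.rev : ℕ) + 1 = s ∧ 0 < reverseSkipComposition n S q := by
  constructor
  · intro hs
    have h := Finset.mem_Icc.mp (hS hs)
    refine ⟨(⟨s - 1, by omega⟩ : Fin n).rev, ?_, ?_⟩
    · rw [Fin.rev_rev, Nat.sub_add_cancel h.1]
    · rw [reverseSkipComposition, Fin.rev_rev, skipComposition_pos_iff]
      simpa only [Nat.sub_add_cancel h.1] using hs
  · rintro ⟨q, rfl, hq⟩
    rwa [reverseSkipComposition, skipComposition_pos_iff] at hq

/-- The support of the composition recovers the set, so comparison of compositions gives inclusion,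
and equal cardinality gives equality. -/
theorem eq_of_reverseSkipComposition_le {S S' : Finset ℕ} (hS : S ⊆ Finset.Icc 1 (n - 1))
    (hS' : S' ⊆ Finset.Icc 1 (n - 1)) (hcard : S.card = S'.card)
    (h : ∀ q, reverseSkipComposition n S q ≤ reverseSkipComposition n S' q) : S = S' := by
  refine Finset.eq_of_subset_of_card_le (fun s hs => ?_) hcard.ge
  rw [mem_iff_reverseSkipComposition_pos hS] at hs
  rw [mem_iff_reverseSkipComposition_pos hS']
  obtain ⟨q, h1, h2⟩ := hs
  exact ⟨q, h1, h2.trans_le (h q)⟩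

/-- At most n-1-s elements of S exceed s = s_j, so j ≥ s-k+2 and the entry s-j+1 is at most k-1. -/
theorem reverseSkipComposition_lt (hk : 1 ≤ k) (hkn : k ≤ n) {S : Finset ℕ}
    (hS : S ⊆ Finset.Icc 1 (n - 1)) (hcard : S.card = n - k + 1) (q : Fin n) :
    reverseSkipComposition n S q < k := by
  rw [reverseSkipComposition, skipComposition]
  split_ifs with hq
  · have h1 : (S.filter fun s => ¬ s ≤ (q.rev : ℕ) + 1).card ≤ n - 1 - (q.rev + 1) := by
      rw [← Nat.card_Ioc]
      refine Finset.card_le_card fun s hs => ?_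
      rw [Finset.mem_filter] at hs
      rw [Finset.mem_Ioc]
      exact ⟨not_le.mp hs.2, (Finset.mem_Icc.mp (hS hs.1)).2⟩
    have h2 := Finset.card_filter_add_card_filter_not (s := S) (· ≤ (q.rev : ℕ) + 1)
    have h3 := Finset.mem_Icc.mp (hS hq)
    -- This is j ≤ s_j, which keeps the natural subtraction in the entry from being truncated.
    have h4 : (S.filter (· ≤ (q.rev : ℕ) + 1)).card ≤ (q.rev : ℕ) + 1 := by
      conv_rhs => rw [← Nat.add_sub_cancel (n := (q.rev : ℕ) + 1) (m := 1), ← Nat.card_Icc]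
      refine Finset.card_le_card fun s hs => ?_
      rw [Finset.mem_filter] at hs
      exact Finset.mem_Icc.mpr ⟨(Finset.mem_Icc.mp (hS hs.1)).1, hs.2⟩
    omega
  · exact hk

/-- Character exponents stay below k, so no x_i^k divides their monomials. Conversely, such a
monomial involves n-k+1 ≥ 2 variables and cannot divide a pure power; this is where k < n enters, as
for k = n these monomials are themselves pure powers. -/
theorem not_degree_le_of_mem_groebnerSet (hk : 1 ≤ k) (hkn : k < n)
    {g g' : MvPolynomial (Fin n) F} (hg : g ∈ groebnerSet F n k) (hg' : g' ∈ groebnerSet F n k)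
    (hne : g ≠ g') : ¬ (neglex n).degree g ≤ (neglex n).degree g' := by
  intro hle
  rcases hg with ⟨i, hi, h1, rfl⟩ | ⟨S, hS, hcard, rfl⟩ <;>
    rcases hg' with ⟨i', hi', h1', rfl⟩ | ⟨S', hS', hcard', rfl⟩
  · rw [(completeHomogeneous_monic hi h1).2, (completeHomogeneous_monic hi' h1').2,
      Finsupp.single_le_iff, Finsupp.single_apply] at hle
    split_ifs at hle with h
    · rw [Fin.mk.injEq] at h
      obtain rfl : i = i' := by omega
      exact hne rfl
    · omega
  · rw [(completeHomogeneous_monic hi h1).2, (demazureCharacter_monic hkn.le hS' hcard').2,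
      Finsupp.single_le_iff, Finsupp.equivFunOnFinite_symm_apply_apply] at hle
    have := reverseSkipComposition_lt hk hkn.le hS' hcard' ⟨i - 1, by omega⟩
    omega
  · rw [(completeHomogeneous_monic hi' h1').2, (demazureCharacter_monic hkn.le hS hcard).2] at hle
    have hsub : S ⊆ {((⟨i' - 1, by omega⟩ : Fin n).rev : ℕ) + 1} := by
      intro s hs
      obtain ⟨q, rfl, hq⟩ := (mem_iff_reverseSkipComposition_pos hS s).mp hs
      have h2 := hle q
      rw [Finsupp.equivFunOnFinite_symm_apply_apply, Finsupp.single_apply] at h2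
      split_ifs at h2 with h
      · rw [h, Finset.mem_singleton]
      · omega
    have := Finset.card_le_card hsub
    rw [Finset.card_singleton] at this
    omega
  · rw [(demazureCharacter_monic hkn.le hS hcard).2,
      (demazureCharacter_monic hkn.le hS' hcard').2] at hle
    obtain rfl := eq_of_reverseSkipComposition_le hS hS' (hcard.trans hcard'.symm) hle
    exact hne rfl

theorem isMinimalGroebnerBasis_groebnerSet (hk : 1 ≤ k) (hkn : k < n) :
    IsMinimalGroebnerBasis (neglex n) (groebnerSet F n k) (idealJ F n k) where
  toIsGroebnerBasis := isGroebnerBasis_groebnerSet hk hkn.le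
  leadingCoeff_eq_one := fun _ hg => (monic_of_mem_groebnerSet hkn.le hg).leadingCoeff_eq_one
  not_dvd := fun g hg g' hg' hne hdvd => by
    rw [monomial_dvd_monomial] at hdvd
    exact not_degree_le_of_mem_groebnerSet hk hkn hg hg' hne
      (hdvd.1.resolve_left one_ne_zero)

end Basis

end

end ZeroHecke

theorem mainTheorem6 {F : Type*} [Field F] (n k : ℕ) (hk : 1 ≤ k) (hkn : k ≤ n) :
    ZeroHecke.IsGroebnerBasis (ZeroHecke.neglex n) (ZeroHecke.groebnerSet F n k)
        (ZeroHecke.idealJ F n k) ∧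
      (k < n →
        ZeroHecke.IsMinimalGroebnerBasis (ZeroHecke.neglex n) (ZeroHecke.groebnerSet F n k)
          (ZeroHecke.idealJ F n k)) :=
  ⟨ZeroHecke.isGroebnerBasis_groebnerSet hk hkn,
    fun h => ZeroHecke.isMinimalGroebnerBasis_groebnerSet hk h⟩
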